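/- **Setting.** Let $\mathcal X_1,\mathcal X_2,\mathcal Y_1,\mathcal Y_2$ be finite alphabets and $p^*(y_1,y_2|x_1,x_2)$ a memoryless channel (used without feedback). Logarithms are to base 2 and $C_{12},C_{21}\ge 0$. A code of block length $n$ with $K\ge 0$ conferencing rounds and message sets $\mathcal W_i=\{1,\dots,\lfloor 2^{nR_i}\rfloor\}$ ($i=0,1,2$) consists of encoders $f_i:\mathcal W_0\times\mathcal W_i\to\mathcal X_i^n$ ($i=1,2$), finite conferencing alphabets $\mathcal V_{1,k},\mathcal V_{2,k}$ ($k=1,\dots,K$), conferencing functions $$g_{1,k}:\mathcal Y_1^n\times\mathcal V_{2,1}\times\cdots\times\mathcal V_{2,k-1}\to\mathcal V_{1,k},\qquad g_{2,k}:\mathcal Y_2^n\times\mathcal V_{1,1}\times\cdots\times\mathcal V_{1,k-1}\to\mathcal V_{2,k},$$ and decoders $h_1:\mathcal Y_1^n\times\mathcal V_{2,1}\times\cdots\times\mathcal V_{2,K}\to\mathcal W_0\times\mathcal W_1\times\mathcal W_2$ and $h_2:\mathcal Y_2^n\times\mathcal V_{1,1}\times\cdots\times\mathcal V_{1,K}\to\mathcal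 W_0\times\mathcal W_1\times\mathcal W_2$. Here the arguments from $\mathcal V_{i,k}$ are the letters produced by $g_{i,k}$ in the conference. Its error probability $P_e$ is the probability, for uniformly distributed independent messages, that at least one of the two decoders does not output the triple of messages that was sent. A triple $(R_0,R_1,R_2)$ of nonnegative reals is *achievable* if for every $\varepsilon>0$ and all sufficiently large $n$ there is such a code, for some $K$, with $P_e\le\varepsilon$ and $$\sum_{k=1}^K\log_2|\mathcal V_{1,k}|\le nC_{12},\qquad \sum_{k=1}^K\log_2|\mathcal V_{2,k}|\le nC_{21}.$$ The capacity region $\mathcal C_{CM}(C_{12},C_{21})$ is the closure of the set of achievable triples. For a distribution $p(u)p(x_1|u)p(x_2|u)p^*(y_1,y_2|x_1,x_2)$ with $U$ in a finite alphabet, for an observation $Y\in\{Y_1,Y_2,(Y_1,Y_2)\}$ and a number $C\ge 0$, let $\mathcal R_Y+C$ be the set of all $(R_0,R_1,R_2)$ with $R_0,R_1,R_2\ge0$ and $$R_1\le I(X_1;Y|X_2U)+C,\quad R_2\le I(X_2;Y|X_1U)+C,\quad R_1+R_2\le I(X_1X_2;Y|U)+C,\quad R_0+R_1+R_2\le I(X_1X_2;Y)+C.$$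 Write $\mathcal R_{MAC,1}+C=\mathcal R_{Y_1}+C$, $\mathcal R_{MAC,2}+C=\mathcal R_{Y_2}+C$ and $\mathcal R_{MAC,FC}=\mathcal R_{(Y_1,Y_2)}+0$. **Proposition 1.** $\mathcal C_{CM}(C_{12},C_{21})\subseteq\mathcal C_{CM\text{-}out}(C_{12},C_{21})$, where $$\mathcal C_{CM\text{-}out}(C_{12},C_{21})=\bigcup\big\{(\mathcal R_{MAC,1}+C_{21})\cap(\mathcal R_{MAC,2}+C_{12})\cap\mathcal R_{MAC,FC}\big\},$$ the union being over all distributions $p(u)p(x_1|u)p(x_2|u)p^*(y_1,y_2|x_1,x_2)$ with $U$ in an arbitrary finite alphabet. Equivalently, $\mathcal C_{CM\text{-}out}(C_{12},C_{21})$ is the union, over the same distributions, of the sets of all $(R_0,R_1,R_2)$ with $R_0,R_1,R_2\ge0$ and $$\begin{aligned} R_1&\le\min\{I(X_1;Y_1|X_2U)+C_{21},\ I(X_1;Y_2|X_2U)+C_{12},\ I(X_1;Y_1Y_2|X_2U)\},\\ R_2&\le\min\{I(X_2;Y_1|X_1U)+C_{21},\ I(X_2;Y_2|X_1U)+C_{12},\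 I(X_2;Y_1Y_2|X_1U)\},\\ R_1+R_2&\le\min\{I(X_1X_2;Y_1|U)+C_{21},\ I(X_1X_2;Y_2|U)+C_{12},\ I(X_1X_2;Y_1Y_2|U)\},\\ R_0+R_1+R_2&\le\min\{I(X_1X_2;Y_1)+C_{21},\ I(X_1X_2;Y_2)+C_{12},\ I(X_1X_2;Y_1Y_2)\}. \end{aligned}$$ -/

import Mathlib

/-! ### Information measures of random variables on a finite probability space (in bits) -/

namespace CompoundMAC

noncomputable section

open Classical in
/-- Probability that the random variable `f` takes the value `a`, when the sample space `Ω`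
carries the probability mass function `p`. -/
def prob {Ω α : Type*} [Fintype Ω] (p : Ω → ℝ) (f : Ω → α) (a : α) : ℝ :=
  ∑ ω, if f ω = a then p ω else 0

/-- Shannon entropy `H(f)` in bits, with the convention `0 log 0 = 0`. -/
def entropy {Ω α : Type*} [Fintype Ω] [Fintype α] (p : Ω → ℝ) (f : Ω → α) : ℝ :=
  -∑ a, prob p f a * Real.logb 2 (prob p f a)

/-- Conditional entropy `H(f | h) = H(f, h) - H(h)`. -/
def condEntropy {Ω α γ : Type*} [Fintype Ω] [Fintype α] [Fintype γ]
    (p : Ω → ℝ) (f : Ω → α) (h : Ω → γ) : ℝ :=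
  entropy p (fun ω => (f ω, h ω)) - entropy p h

/-- Mutual information `I(f ; g) = H(f) - H(f | g)`. -/
def mutualInfo {Ω α β : Type*} [Fintype Ω] [Fintype α] [Fintype β]
    (p : Ω → ℝ) (f : Ω → α) (g : Ω → β) : ℝ :=
  entropy p f - condEntropy p f g

/-- Conditional mutual information `I(f ; g | h) = H(f | h) - H(f | g, h)`. -/
def condMutualInfo {Ω α β γ : Type*} [Fintype Ω] [Fintype α] [Fintype β] [Fintype γ]
    (p : Ω → ℝ) (f : Ω → α) (g : Ω → β) (h : Ω → γ) : ℝ :=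
  condEntropy p f h - condEntropy p f (fun ω => (g ω, h ω))

/-! ### The channel and its codes -/

/-- A discrete memoryless compound multiple access channel: for every pair of input letters,
a probability mass function on the pairs of output letters. -/
abbrev Channel (X₁ X₂ Y₁ Y₂ : Type*) [Fintype Y₁] [Fintype Y₂] : Type _ :=
  X₁ → X₂ → stdSimplex ℝ (Y₁ × Y₂)

/-- A code of block length `n` with message sets of sizes `M₀, M₁, M₂` and `K` conferencing
rounds between the decoders. The conferencing alphabets of round `k` have `v₁ k` letters
(from decoder 1 to decoder 2) and `v₂ k` letters (from decoder 2 to decoder 1). Either decoder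
estimates all three messages. -/
structure Code (X₁ X₂ Y₁ Y₂ : Type*) (M₀ M₁ M₂ n K : ℕ) where
  enc₁ : Fin M₀ → Fin M₁ → Fin n → X₁
  enc₂ : Fin M₀ → Fin M₂ → Fin n → X₂
  v₁ : Fin K → ℕ
  v₂ : Fin K → ℕ
  conf₁ : ∀ k : Fin K, (Fin n → Y₁) → (∀ j : Fin K, j < k → Fin (v₂ j)) → Fin (v₁ k)
  conf₂ : ∀ k : Fin K, (Fin n → Y₂) → (∀ j : Fin K, j < k → Fin (v₁ j)) → Fin (v₂ k)
  dec₁ : (Fin n → Y₁) → (∀ k : Fin K, Fin (v₂ k)) → Fin M₀ × Fin M₁ × Fin M₂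
  dec₂ : (Fin n → Y₂) → (∀ k : Fin K, Fin (v₁ k)) → Fin M₀ × Fin M₁ × Fin M₂

namespace Code

variable {X₁ X₂ Y₁ Y₂ : Type*} {M₀ M₁ M₂ n K : ℕ}

/-- The pair of conferencing letters that decoders 1 and 2 send simultaneously in round `k`. -/
def transcript (c : Code X₁ X₂ Y₁ Y₂ M₀ M₁ M₂ n K) (y₁ : Fin n → Y₁) (y₂ : Fin n → Y₂)
    (k : Fin K) : Fin (c.v₁ k) × Fin (c.v₂ k) :=
  (c.conf₁ k y₁ (fun j _ => (transcript c y₁ y₂ j).2),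
   c.conf₂ k y₂ (fun j _ => (transcript c y₁ y₂ j).1))
termination_by k

/-- The estimate of decoder 1 after the conference. -/
def est₁ (c : Code X₁ X₂ Y₁ Y₂ M₀ M₁ M₂ n K) (y₁ : Fin n → Y₁) (y₂ : Fin n → Y₂) :
    Fin M₀ × Fin M₁ × Fin M₂ :=
  c.dec₁ y₁ (fun k => (c.transcript y₁ y₂ k).2)

/-- The estimate of decoder 2 after the conference. -/
def est₂ (c : Code X₁ X₂ Y₁ Y₂ M₀ M₁ M₂ n K) (y₁ : Fin n → Y₁) (y₂ : Fin n → Y₂) :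
    Fin M₀ × Fin M₁ × Fin M₂ :=
  c.dec₂ y₂ (fun k => (c.transcript y₁ y₂ k).1)

/-- Probability that the outputs are `y₁, y₂` when the message triple `w` is sent; the channel is
memoryless and used without feedback. -/
def outputProb [Fintype Y₁] [Fintype Y₂] (c : Code X₁ X₂ Y₁ Y₂ M₀ M₁ M₂ n K)
    (W : Channel X₁ X₂ Y₁ Y₂) (w : Fin M₀ × Fin M₁ × Fin M₂)
    (y₁ : Fin n → Y₁) (y₂ : Fin n → Y₂) : ℝ :=
  ∏ j, (W (c.enc₁ w.1 w.2.1 j) (c.enc₂ w.1 w.2.2 j)).1 (y₁ j, y₂ j)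

open Classical in
/-- Average probability that at least one of the two decoders errs, for uniformly distributed
messages. -/
def errorProb [Fintype Y₁] [Fintype Y₂] (c : Code X₁ X₂ Y₁ Y₂ M₀ M₁ M₂ n K)
    (W : Channel X₁ X₂ Y₁ Y₂) : ℝ :=
  (1 / ((M₀ : ℝ) * M₁ * M₂)) *
    ∑ w : Fin M₀ × Fin M₁ × Fin M₂, ∑ y₁ : Fin n → Y₁, ∑ y₂ : Fin n → Y₂,
      if c.est₁ y₁ y₂ ≠ w ∨ c.est₂ y₁ y₂ ≠ w then c.outputProb W w y₁ y₂ else 0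

end Code

/-- The size of the message set `{1, 2, …, 2 ^ (n R)}`. -/
def messageCount (n : ℕ) (R : ℝ) : ℕ := ⌊(2 : ℝ) ^ ((n : ℝ) * R)⌋₊

/-- Achievability of the rate triple `R = (R₀, R₁, R₂)` with conferencing capacities
`C₁₂` (from decoder 1 to decoder 2) and `C₂₁` (from decoder 2 to decoder 1), in bits per
channel use. The number of conferencing rounds is unrestricted. -/
def Achievable {X₁ X₂ Y₁ Y₂ : Type*} [Fintype Y₁] [Fintype Y₂] (W : Channel X₁ X₂ Y₁ Y₂)
    (C₁₂ C₂₁ : ℝ) (R : ℝ × ℝ × ℝ) : Prop :=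
  0 ≤ R.1 ∧ 0 ≤ R.2.1 ∧ 0 ≤ R.2.2 ∧
  ∀ ε : ℝ, 0 < ε → ∃ N : ℕ, ∀ n : ℕ, N ≤ n → ∃ K : ℕ,
    ∃ c : Code X₁ X₂ Y₁ Y₂ (messageCount n R.1) (messageCount n R.2.1)
        (messageCount n R.2.2) n K,
      (∑ k, Real.logb 2 (c.v₁ k) ≤ n * C₁₂) ∧
      (∑ k, Real.logb 2 (c.v₂ k) ≤ n * C₂₁) ∧
      c.errorProb W ≤ ε

/-- The capacity region: the closure of the set of achievable rate triples. -/
def capacityRegion {X₁ X₂ Y₁ Y₂ : Type*} [Fintype Y₁] [Fintype Y₂] (W : Channel X₁ X₂ Y₁ Y₂)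
    (C₁₂ C₂₁ : ℝ) : Set (ℝ × ℝ × ℝ) :=
  closure {R | Achievable W C₁₂ C₂₁ R}

/-! ### Single-letter regions -/

/-- The sample space of the tuple `(U, X₁, X₂, Y₁, Y₂)`. -/
abbrev Letters (U X₁ X₂ Y₁ Y₂ : Type*) : Type _ := U × X₁ × X₂ × Y₁ × Y₂

/-- The joint probability mass function `p(u) p(x₁|u) p(x₂|u) p*(y₁,y₂|x₁,x₂)`. -/
def jointLaw {U X₁ X₂ Y₁ Y₂ : Type*} [Fintype U] [Fintype X₁] [Fintype X₂] [Fintype Y₁]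
    [Fintype Y₂] (W : Channel X₁ X₂ Y₁ Y₂) (pU : stdSimplex ℝ U)
    (p₁ : U → stdSimplex ℝ X₁) (p₂ : U → stdSimplex ℝ X₂) : Letters U X₁ X₂ Y₁ Y₂ → ℝ :=
  fun ⟨u, x₁, x₂, y₁, y₂⟩ => pU.1 u * (p₁ u).1 x₁ * (p₂ u).1 x₂ * (W x₁ x₂).1 (y₁, y₂)

section Variables

variable {U X₁ X₂ Y₁ Y₂ : Type*}

/-- The random variable `U`. -/
def rvU (ω : Letters U X₁ X₂ Y₁ Y₂) : U := ω.1
/-- The random variable `X₁`. -/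
def rvX₁ (ω : Letters U X₁ X₂ Y₁ Y₂) : X₁ := ω.2.1
/-- The random variable `X₂`. -/
def rvX₂ (ω : Letters U X₁ X₂ Y₁ Y₂) : X₂ := ω.2.2.1
/-- The random variable `Y₁`. -/
def rvY₁ (ω : Letters U X₁ X₂ Y₁ Y₂) : Y₁ := ω.2.2.2.1
/-- The random variable `Y₂`. -/
def rvY₂ (ω : Letters U X₁ X₂ Y₁ Y₂) : Y₂ := ω.2.2.2.2
/-- The pair of outputs `(Y₁, Y₂)`, as seen by fully cooperating receivers. -/
def rvY₁₂ (ω : Letters U X₁ X₂ Y₁ Y₂) : Y₁ × Y₂ := ω.2.2.2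
/-- The pair of inputs `(X₁, X₂)`. -/
def rvX₁₂ (ω : Letters U X₁ X₂ Y₁ Y₂) : X₁ × X₂ := (ω.2.1, ω.2.2.1)
/-- The pair `(X₁, U)`. -/
def rvX₁U (ω : Letters U X₁ X₂ Y₁ Y₂) : X₁ × U := (ω.2.1, ω.1)
/-- The pair `(X₂, U)`. -/
def rvX₂U (ω : Letters U X₁ X₂ Y₁ Y₂) : X₂ × U := (ω.2.2.1, ω.1)

variable [Fintype U] [Fintype X₁] [Fintype X₂] [Fintype Y₁] [Fintype Y₂]

/-- The rate region of a multiple access channel with a common message, with receiver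
observation `Y`, each of whose information bounds is relaxed by `C`. With `C = 0` this is the
region `R_MAC` itself. -/
def macRegion {B : Type*} [Fintype B] (p : Letters U X₁ X₂ Y₁ Y₂ → ℝ)
    (Y : Letters U X₁ X₂ Y₁ Y₂ → B) (C : ℝ) : Set (ℝ × ℝ × ℝ) :=
  {R | 0 ≤ R.1 ∧ 0 ≤ R.2.1 ∧ 0 ≤ R.2.2 ∧
    R.2.1 ≤ condMutualInfo p rvX₁ Y rvX₂U + C ∧
    R.2.2 ≤ condMutualInfo p rvX₂ Y rvX₁U + C ∧
    R.2.1 + R.2.2 ≤ condMutualInfo p rvX₁₂ Y rvU + C ∧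
    R.1 + R.2.1 + R.2.2 ≤ mutualInfo p rvX₁₂ Y + C}

end Variables

/-- The outer region: the union, over all finite alphabets of `U` and all
`p(u), p(x₁|u), p(x₂|u)`, of `(R_MAC,1 + C₂₁) ∩ (R_MAC,2 + C₁₂) ∩ R_MAC,FC`. -/
def outerRegion {X₁ X₂ Y₁ Y₂ : Type*} [Fintype X₁] [Fintype X₂] [Fintype Y₁] [Fintype Y₂]
    (W : Channel X₁ X₂ Y₁ Y₂) (C₁₂ C₂₁ : ℝ) : Set (ℝ × ℝ × ℝ) :=
  ⋃ (m : ℕ) (pU : stdSimplex ℝ (Fin m)) (p₁ : Fin m → stdSimplex ℝ X₁)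
    (p₂ : Fin m → stdSimplex ℝ X₂),
    macRegion (jointLaw W pU p₁ p₂) rvY₁ C₂₁ ∩
    macRegion (jointLaw W pU p₁ p₂) rvY₂ C₁₂ ∩
    macRegion (jointLaw W pU p₁ p₂) rvY₁₂ 0

/-- The explicit description of the outer region, with each rate bounded by the minimum of
three informations. -/
def outerRegionExplicit {X₁ X₂ Y₁ Y₂ : Type*} [Fintype X₁] [Fintype X₂] [Fintype Y₁]
    [Fintype Y₂] (W : Channel X₁ X₂ Y₁ Y₂) (C₁₂ C₂₁ : ℝ) : Set (ℝ × ℝ × ℝ) :=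
  {R | ∃ (m : ℕ) (pU : stdSimplex ℝ (Fin m)) (p₁ : Fin m → stdSimplex ℝ X₁)
      (p₂ : Fin m → stdSimplex ℝ X₂),
    let p := jointLaw W pU p₁ p₂
    0 ≤ R.1 ∧ 0 ≤ R.2.1 ∧ 0 ≤ R.2.2 ∧
    R.2.1 ≤ min (condMutualInfo p rvX₁ rvY₁ rvX₂U + C₂₁)
      (min (condMutualInfo p rvX₁ rvY₂ rvX₂U + C₁₂) (condMutualInfo p rvX₁ rvY₁₂ rvX₂U)) ∧
    R.2.2 ≤ min (condMutualInfo p rvX₂ rvY₁ rvX₁U + C₂₁)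
      (min (condMutualInfo p rvX₂ rvY₂ rvX₁U + C₁₂) (condMutualInfo p rvX₂ rvY₁₂ rvX₁U)) ∧
    R.2.1 + R.2.2 ≤ min (condMutualInfo p rvX₁₂ rvY₁ rvU + C₂₁)
      (min (condMutualInfo p rvX₁₂ rvY₂ rvU + C₁₂) (condMutualInfo p rvX₁₂ rvY₁₂ rvU)) ∧
    R.1 + R.2.1 + R.2.2 ≤ min (mutualInfo p rvX₁₂ rvY₁ + C₂₁)
      (min (mutualInfo p rvX₁₂ rvY₂ + C₁₂) (mutualInfo p rvX₁₂ rvY₁₂))}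

end

end CompoundMAC

/-! Each decoder is a multiple access receiver that sees its own output block together with a help
letter `V`, the whole list of conference letters it received. However the rounds interact, `V` takes
at most 2^(nC) values, so by the chain rule it raises any information bound by at most nC bits. The
third set of constraints comes from a receiver that sees both output blocks: it can simulate the
conference itself and needs no help.

For one code, split the messages into a part `f` to be decoded and a part `T` taken as known. Fano's
inequality gives H(f|T) ≤ I(f;Z|T) + nC + 1 + Pe log|f| for the observed block Z
(`condEntropy_message_le`). Subadditivity bounds H(Z|T) by a sum over positions
(`condEntropy_pi_le`), and memorylessness makes H(Z | all messages) equal to such a sum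
(`condEntropy_outputs`). Taking U to be the pair (position, common message) makes the two input
letters independent given U, and the same U and input laws serve all three observations. The bound
on the sum of all three rates also needs concavity of mutual information in the input law
(`rateTotal_concave`).

This puts the rates in the outer region up to a slack η, with an alphabet of U that grows with n. To
let η tend to 0, the pairs (input law, conditional informations) are viewed as points of the convex
hull of a continuous image of a product of simplices. In finite dimension this hull is compact, so
the set of (R, η) that satisfy the constraints is closed. That disposes both of the slack and of the
closure in the capacity region. A point of the hull is itself a finite mixture, which supplies the
finite alphabet of U. -/

namespace CompoundMAC

noncomputable section

/-! ### Entropy inequalities on a finite probability space -/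

section Shannon

set_option linter.unusedSectionVars false

variable {Ω α β γ ν : Type*} [Fintype Ω] [Fintype α] [Fintype β] [Fintype γ] [Fintype ν]

theorem prob_nonneg {p : Ω → ℝ} (hp : ∀ ω, 0 ≤ p ω) (f : Ω → α) (a : α) : 0 ≤ prob p f a := by
  unfold prob
  exact Finset.sum_nonneg fun ω _ => by split_ifs <;> simp [hp]

theorem le_prob_self {p : Ω → ℝ} (hp : ∀ ω, 0 ≤ p ω) (f : Ω → α) (ω : Ω) :
    p ω ≤ prob p f (f ω) := by
  classical
  unfold prob
  have := Finset.single_le_sum (f := fun ω' => if f ω' = f ω then p ω' else 0)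
    (fun ω' _ => by split_ifs <;> simp [hp]) (Finset.mem_univ ω)
  simpa using this

theorem sum_mul_comp (p : Ω → ℝ) (f : Ω → α) (F : α → ℝ) :
    ∑ ω, p ω * F (f ω) = ∑ a, prob p f a * F a := by
  classical
  unfold prob
  simp_rw [Finset.sum_mul, ite_mul, zero_mul]
  rw [Finset.sum_comm]
  simp

theorem sum_prob (p : Ω → ℝ) (f : Ω → α) : ∑ a, prob p f a = ∑ ω, p ω := by
  simpa using (sum_mul_comp p f fun _ => 1).symm

theorem prob_congr (p : Ω → ℝ) {f : Ω → α} {g : Ω → β} {a : α} {b : β}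
    (h : ∀ ω, f ω = a ↔ g ω = b) : prob p f a = prob p g b := by
  classical
  unfold prob
  exact Finset.sum_congr rfl fun ω _ => if_congr (h ω) rfl rfl

theorem sum_prob_pair (p : Ω → ℝ) (f : Ω → α) (h : Ω → γ) (c : γ) :
    ∑ a, prob p (fun ω => (f ω, h ω)) (a, c) = prob p h c := by
  classical
  unfold prob
  rw [Finset.sum_comm]
  refine Finset.sum_congr rfl fun ω _ => ?_
  by_cases hc : h ω = c <;> simp [hc]

theorem prob_pair_le {p : Ω → ℝ} (hp : ∀ ω, 0 ≤ p ω) (f : Ω → α) (h : Ω → γ) (a : α) (c : γ) :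
    prob p (fun ω => (f ω, h ω)) (a, c) ≤ prob p h c := by
  rw [← sum_prob_pair p f h c]
  exact Finset.single_le_sum (f := fun a => prob p (fun ω => (f ω, h ω)) (a, c))
    (fun _ _ => prob_nonneg hp _ _) (Finset.mem_univ a)

theorem entropy_eq_sum (p : Ω → ℝ) (f : Ω → α) :
    entropy p f = -∑ ω, p ω * Real.logb 2 (prob p f (f ω)) := by
  rw [sum_mul_comp p f fun a => Real.logb 2 (prob p f a)]
  rfl

/-- Entropy depends only on the partition of the sample space. -/
theorem entropy_congr (p : Ω → ℝ) {f : Ω → α} {g : Ω → β}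
    (h : ∀ ω ω', f ω = f ω' ↔ g ω = g ω') : entropy p f = entropy p g := by
  rw [entropy_eq_sum, entropy_eq_sum]
  congr 1
  refine Finset.sum_congr rfl fun ω _ => ?_
  rw [prob_congr p fun ω' => h ω' ω]

theorem condEntropy_eq_sum {p : Ω → ℝ} (hp : ∀ ω, 0 ≤ p ω) (f : Ω → α) (h : Ω → γ) :
    condEntropy p f h = -∑ ω, p ω * Real.logb 2
      (prob p (fun ω => (f ω, h ω)) (f ω, h ω) / prob p h (h ω)) := by
  rw [condEntropy, entropy_eq_sum, entropy_eq_sum, neg_sub_neg, ← Finset.sum_sub_distrib,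
    ← Finset.sum_neg_distrib]
  refine Finset.sum_congr rfl fun ω _ => ?_
  rcases (hp ω).eq_or_lt with h0 | h0
  · simp [← h0]
  · rw [Real.logb_div (h0.trans_le (le_prob_self hp (fun ω => (f ω, h ω)) ω)).ne'
      (h0.trans_le (le_prob_self hp h ω)).ne']
    ring

theorem condEntropy_nonneg {p : Ω → ℝ} (hp : ∀ ω, 0 ≤ p ω) (f : Ω → α) (h : Ω → γ) :
    0 ≤ condEntropy p f h := by
  rw [condEntropy_eq_sum hp, neg_nonneg]
  refine Finset.sum_nonpos fun ω _ => mul_nonpos_of_nonneg_of_nonpos (hp ω) ?_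
  refine Real.logb_nonpos one_lt_two
    (div_nonneg (prob_nonneg hp _ _) (prob_nonneg hp _ _)) ?_
  exact div_le_one_of_le₀ (prob_pair_le hp f h _ _) (prob_nonneg hp _ _)

/-- Gibbs' inequality for conditional entropy. -/
theorem condEntropy_le {p : Ω → ℝ} (hp : ∀ ω, 0 ≤ p ω) (hp1 : ∑ ω, p ω = 1)
    (f : Ω → α) (h : Ω → γ) (q : γ → α → ℝ) (hq : ∀ c a, 0 ≤ q c a)
    (hq1 : ∀ c, ∑ a, q c a ≤ 1) (hpos : ∀ ω, 0 < p ω → 0 < q (h ω) (f ω)) :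
    condEntropy p f h ≤ -∑ ω, p ω * Real.logb 2 (q (h ω) (f ω)) := by
  set P : α × γ → ℝ := prob p (fun ω => (f ω, h ω)) with hP
  -- This is log t ≤ t - 1 at t = q(f|h) / P(f|h), weighted by `p ω`.
  have key : ∀ ω, p ω * Real.logb 2 (q (h ω) (f ω))
        - p ω * Real.logb 2 (P (f ω, h ω) / prob p h (h ω))
      ≤ (p ω * (q (h ω) (f ω) * prob p h (h ω) / P (f ω, h ω)) - p ω) / Real.log 2 := by
    intro ω
    rcases (hp ω).eq_or_lt with h0 | h0
    · simp [← h0]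
    have h1 : 0 < P (f ω, h ω) := h0.trans_le (le_prob_self hp (fun ω => (f ω, h ω)) ω)
    have h2 : 0 < prob p h (h ω) := h0.trans_le (le_prob_self hp h ω)
    have h3 := hpos ω h0
    rw [← mul_sub, ← Real.logb_div h3.ne' (div_pos h1 h2).ne', Real.logb, mul_div_assoc',
      div_le_div_iff_of_pos_right (Real.log_pos one_lt_two), ← mul_sub_one]
    refine mul_le_mul_of_nonneg_left ?_ h0.le
    rw [div_div_eq_mul_div]
    exact Real.log_le_sub_one_of_pos (by positivity)
  have hsum : ∑ ω, p ω * (q (h ω) (f ω) * prob p h (h ω) / P (f ω, h ω)) ≤ 1 := by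
    rw [sum_mul_comp p (fun ω => (f ω, h ω)) fun x => q x.2 x.1 * prob p h x.2 / P x]
    calc ∑ x, P x * (q x.2 x.1 * prob p h x.2 / P x)
        ≤ ∑ x : α × γ, q x.2 x.1 * prob p h x.2 := by
          refine Finset.sum_le_sum fun x _ => ?_
          have hn : 0 ≤ q x.2 x.1 * prob p h x.2 := mul_nonneg (hq _ _) (prob_nonneg hp _ _)
          rcases eq_or_ne (P x) 0 with h0 | h0
          · simpa [h0] using hn
          · rw [mul_div_cancel₀ _ h0]
      _ = ∑ c, (∑ a, q c a) * prob p h c := by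
          simp_rw [Fintype.sum_prod_type_right, Finset.sum_mul]
      _ ≤ ∑ c, 1 * prob p h c :=
          Finset.sum_le_sum fun c _ => mul_le_mul_of_nonneg_right (hq1 c) (prob_nonneg hp _ _)
      _ = 1 := by simp [sum_prob, hp1]
  have := Finset.sum_le_sum fun ω (_ : ω ∈ Finset.univ) => key ω
  rw [Finset.sum_sub_distrib, ← Finset.sum_div, Finset.sum_sub_distrib, hp1] at this
  have h0 : (∑ ω, p ω * (q (h ω) (f ω) * prob p h (h ω) / P (f ω, h ω)) - 1) / Real.log 2 ≤ 0 :=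
    div_nonpos_of_nonpos_of_nonneg (by linarith) (Real.log_pos one_lt_two).le
  rw [condEntropy_eq_sum hp]
  linarith

/-- Gibbs' inequality against the uniform kernel. -/
theorem condEntropy_le_logb_card {p : Ω → ℝ} (hp : ∀ ω, 0 ≤ p ω) (hp1 : ∑ ω, p ω = 1)
    (f : Ω → α) (h : Ω → γ) : condEntropy p f h ≤ Real.logb 2 (Fintype.card α) := by
  have hc : ∀ ω : Ω, 0 < (Fintype.card α : ℝ) := fun ω =>
    Nat.cast_pos.2 (Fintype.card_pos_iff.2 ⟨f ω⟩)
  refine (condEntropy_le hp hp1 f h (fun _ _ => (Fintype.card α : ℝ)⁻¹)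
    (fun _ _ => by positivity) (fun _ => ?_) fun ω _ => inv_pos.2 (hc ω)).trans ?_
  · simpa using mul_inv_le_one
  · simp [← Finset.sum_mul, hp1, Real.logb_inv]

open Classical in
/-- Fano's inequality. -/
theorem condEntropy_le_fano {p : Ω → ℝ} (hp : ∀ ω, 0 ≤ p ω) (hp1 : ∑ ω, p ω = 1)
    (f : Ω → α) (h : Ω → γ) (g : γ → α) :
    condEntropy p f h ≤
      1 + (∑ ω, if g (h ω) ≠ f ω then p ω else 0) * Real.logb 2 (Fintype.card α) := by
  have hc : ∀ a : α, 0 < (Fintype.card α : ℝ) := fun a =>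
    Nat.cast_pos.2 (Fintype.card_pos_iff.2 ⟨a⟩)
  -- The comparison kernel gives weight 1/2 to the guess `g c` and 1/(2|α|) to every other value.
  -- The factor 1/2 produces the constant 1, in place of the binary entropy of the error
  -- probability.
  refine (condEntropy_le hp hp1 f h
    (fun c a => 2⁻¹ * (if g c ≠ a then (Fintype.card α : ℝ)⁻¹ else 1))
    (fun c a => by positivity) (fun c => ?_) fun ω _ => ?_).trans ?_
  · have : ∑ a, (if g c ≠ a then (Fintype.card α : ℝ)⁻¹ else 1) ≤
        ∑ a, ((Fintype.card α : ℝ)⁻¹ + if g c = a then 1 else 0) := by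
      refine Finset.sum_le_sum fun a _ => ?_
      have : (0 : ℝ) ≤ (Fintype.card α : ℝ)⁻¹ := by positivity
      split_ifs <;> simp_all
    rw [Finset.sum_add_distrib] at this
    simp only [Finset.sum_const, Finset.card_univ, nsmul_eq_mul, Finset.sum_ite_eq,
      Finset.mem_univ, if_true] at this
    rw [mul_inv_cancel₀ (hc (g c)).ne'] at this
    rw [← Finset.mul_sum]
    linarith
  · have := hc (f ω)
    split_ifs <;> positivity
  · have hω : ∀ ω, p ω * Real.logb 2 (2⁻¹ * (if g (h ω) ≠ f ω then (Fintype.card α : ℝ)⁻¹ else 1))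
        = -p ω - (if g (h ω) ≠ f ω then p ω else 0) * Real.logb 2 (Fintype.card α) := by
      intro ω
      have := hc (f ω)
      split_ifs
      · rw [Real.logb_mul (by norm_num) (by positivity), Real.logb_inv, Real.logb_inv,
          Real.logb_self_eq_one one_lt_two]
        ring
      · simp [Real.logb_inv]
    simp_rw [hω]
    rw [Finset.sum_sub_distrib, Finset.sum_neg_distrib, hp1, ← Finset.sum_mul]
    linarith

/-- Conditional entropy of a vector is at most the sum of those of its components. -/
theorem condEntropy_pi_le {ι : Type*} [Fintype ι] [DecidableEq ι] {p : Ω → ℝ}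
    (hp : ∀ ω, 0 ≤ p ω) (hp1 : ∑ ω, p ω = 1) (f : Ω → ι → α) (h : Ω → γ) :
    condEntropy p f h ≤ ∑ i, condEntropy p (fun ω => f ω i) h := by
  set P : ι → γ → α → ℝ := fun i c a => prob p (fun ω => (f ω i, h ω)) (a, c) / prob p h c
  have hP : ∀ i ω, 0 < p ω → 0 < P i (h ω) (f ω i) := fun i ω h0 =>
    div_pos (h0.trans_le (le_prob_self hp (fun ω => (f ω i, h ω)) ω))
      (h0.trans_le (le_prob_self hp h ω))
  have hP0 : ∀ i c a, 0 ≤ P i c a := fun i c a =>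
    div_nonneg (prob_nonneg hp _ _) (prob_nonneg hp _ _)
  -- Gibbs' inequality against the product of the conditional laws of the components.
  refine (condEntropy_le hp hp1 f h (fun c a => ∏ i, P i c (a i))
    (fun c a => Finset.prod_nonneg fun i _ => hP0 i _ _) (fun c => ?_)
    fun ω h0 => Finset.prod_pos fun i _ => hP i ω h0).trans_eq ?_
  · rw [← Fintype.piFinset_univ, ← Finset.prod_univ_sum (fun _ => Finset.univ)
      (fun i a => P i c a)]
    refine Finset.prod_le_one (fun i _ => Finset.sum_nonneg fun a _ => hP0 i _ _) fun i _ => ?_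
    rw [← Finset.sum_div, sum_prob_pair]
    -- The quotient is 0/0 = 0 when `h` takes the value `c` with probability zero; hence Gibbs'
    -- inequality is stated for kernels of total mass at most 1.
    exact div_self_le_one _
  · simp_rw [condEntropy_eq_sum hp]
    rw [Finset.sum_neg_distrib, Finset.sum_comm]
    congr 1
    refine Finset.sum_congr rfl fun ω _ => ?_
    rcases (hp ω).eq_or_lt with h0 | h0
    · simp [← h0]
    · rw [Real.logb_prod _ _ fun i _ => (hP i ω h0).ne', Finset.mul_sum]

/-! ### Entropy of mass functions and of kernel outputs -/

/-- Entropy in bits of a probability mass function. -/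
def pmfEntropy (r : α → ℝ) : ℝ := -∑ a, r a * Real.logb 2 (r a)

theorem pmfEntropy_eq (r : α → ℝ) :
    pmfEntropy r = (∑ a, Real.negMulLog (r a)) / Real.log 2 := by
  rw [pmfEntropy, Finset.sum_div, ← Finset.sum_neg_distrib]
  refine Finset.sum_congr rfl fun a _ => ?_
  rw [Real.negMulLog, Real.logb]
  ring

theorem continuous_pmfEntropy : Continuous (pmfEntropy : (α → ℝ) → ℝ) := by
  have : (pmfEntropy : (α → ℝ) → ℝ) =
      fun r => (∑ a, Real.negMulLog (r a)) / Real.log 2 := funext pmfEntropy_eq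
  rw [this]
  exact (continuous_finsetSum _ fun a _ =>
    Real.continuous_negMulLog.comp (continuous_apply a)).div_const _

theorem pmfEntropy_jensen {ι : Type*} [Fintype ι] (w : ι → ℝ) (hw : ∀ i, 0 ≤ w i)
    (hw1 : ∑ i, w i = 1) (r : ι → α → ℝ) (hr : ∀ i a, 0 ≤ r i a) :
    ∑ i, w i * pmfEntropy (r i) ≤ pmfEntropy fun a => ∑ i, w i * r i a := by
  simp_rw [pmfEntropy_eq, mul_div_assoc', ← Finset.sum_div]
  refine div_le_div_of_nonneg_right ?_ (Real.log_pos one_lt_two).le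
  simp_rw [Finset.mul_sum]
  rw [Finset.sum_comm]
  refine Finset.sum_le_sum fun a _ => ?_
  simpa using Real.concaveOn_negMulLog.le_map_sum (t := Finset.univ) (w := w)
    (p := fun i => r i a) (fun i _ => hw i) hw1 (fun i _ => hr i a)

/-- `F` is absorbed into the `i`-th factor and the product of sums is expanded; every other factor
sums to 1. -/
theorem sum_prod_mul_eval {ι : Type*} [Fintype ι] [DecidableEq ι] (r : ι → α → ℝ)
    (hr : ∀ i, ∑ a, r i a = 1) (i : ι) (F : α → ℝ) :
    ∑ y : ι → α, (∏ j, r j (y j)) * F (y i) = ∑ a, r i a * F a := by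
  have h1 : ∀ y : ι → α, (∏ j, r j (y j)) * F (y i) =
      ∏ j, r j (y j) * (if j = i then F (y j) else 1) := fun y => by
    rw [Finset.prod_mul_distrib]
    simp
  simp_rw [h1]
  rw [← Fintype.piFinset_univ, ← Finset.prod_univ_sum (fun _ => Finset.univ)
    (fun j a => r j a * (if j = i then F a else 1)), Finset.prod_eq_single i]
  · simp
  · intro j _ hj
    simp [hj, hr]
  · simp

/-- The logarithm of the product splits wherever no factor vanishes; elsewhere the weight in front
is 0. Each summand then depends on a single coordinate. -/
theorem pmfEntropy_prod {ι : Type*} [Fintype ι] [DecidableEq ι] (r : ι → α → ℝ)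
    (hr : ∀ i, ∑ a, r i a = 1) :
    pmfEntropy (fun y : ι → α => ∏ j, r j (y j)) = ∑ i, pmfEntropy (r i) := by
  have h1 : ∀ y : ι → α, (∏ j, r j (y j)) * Real.logb 2 (∏ j, r j (y j)) =
      ∑ i, (∏ j, r j (y j)) * Real.logb 2 (r i (y i)) := fun y => by
    by_cases h0 : ∃ j, r j (y j) = 0
    · obtain ⟨j, hj⟩ := h0
      have h2 : ∏ j, r j (y j) = 0 := Finset.prod_eq_zero (Finset.mem_univ j) hj
      simp [h2]
    · push Not at h0
      rw [Real.logb_prod _ _ fun i _ => h0 i, Finset.mul_sum]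
  simp_rw [pmfEntropy, h1, Finset.sum_neg_distrib]
  rw [Finset.sum_comm]
  congr 1
  exact Finset.sum_congr rfl fun i _ =>
    sum_prod_mul_eval r hr i fun a => Real.logb 2 (r i a)

/-- Conditional entropy of a variable that is the output of the kernel `r`. -/
theorem condEntropy_of_kernel {p : Ω → ℝ} (hp : ∀ ω, 0 ≤ p ω) (f : Ω → α) (h : Ω → γ)
    (s : γ → ℝ) (r : γ → α → ℝ)
    (hsr : ∀ a c, prob p (fun ω => (f ω, h ω)) (a, c) = s c * r c a)
    (hr : ∀ c, ∑ a, r c a = 1) :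
    condEntropy p f h = ∑ c, s c * pmfEntropy (r c) := by
  have hs : ∀ c, prob p h c = s c := fun c => by
    rw [← sum_prob_pair p f h c]
    simp_rw [hsr, ← Finset.mul_sum, hr, mul_one]
  rw [condEntropy_eq_sum hp]
  have h1 : ∀ ω, p ω * Real.logb 2 (prob p (fun ω => (f ω, h ω)) (f ω, h ω) / prob p h (h ω))
      = p ω * Real.logb 2 (r (h ω) (f ω)) := fun ω => by
    rcases (hp ω).eq_or_lt with h0 | h0
    · simp [← h0]
    · have h2 : s (h ω) ≠ 0 := hs (h ω) ▸ (h0.trans_le (le_prob_self hp h ω)).ne'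
      rw [hsr, hs, mul_div_cancel_left₀ _ h2]
  simp_rw [h1]
  rw [sum_mul_comp p (fun ω => (f ω, h ω)) fun x => Real.logb 2 (r x.2 x.1),
    Fintype.sum_prod_type_right, ← Finset.sum_neg_distrib]
  refine Finset.sum_congr rfl fun c _ => ?_
  rw [pmfEntropy, mul_neg, Finset.mul_sum]
  simp_rw [hsr, mul_assoc]

theorem condEntropy_congr (p : Ω → ℝ) (f : Ω → α) {g : Ω → β} {h : Ω → γ}
    (H : ∀ ω ω', g ω = g ω' ↔ h ω = h ω') : condEntropy p f g = condEntropy p f h := by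
  rw [condEntropy, condEntropy, entropy_congr p H, entropy_congr p (f := fun ω => (f ω, g ω))
    (g := fun ω => (f ω, h ω)) (by intro ω ω'; simp only [Prod.mk.injEq, H ω ω'])]

theorem condEntropy_const {p : Ω → ℝ} (hp1 : ∑ ω, p ω = 1) (f : Ω → α) :
    condEntropy p f (fun _ => ()) = entropy p f := by
  have h1 : entropy p (fun _ : Ω => ()) = 0 := by simp [entropy, prob, hp1]
  rw [condEntropy, h1, sub_zero]
  exact entropy_congr p (by simp)

/-- Trades entropies of the inputs, in which the regions are defined, for entropies of the output,
which the channel kernel determines. -/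
theorem condMutualInfo_symm (p : Ω → ℝ) (f : Ω → α) (g : Ω → β) (h : Ω → γ) :
    condMutualInfo p f g h = condEntropy p g h - condEntropy p g (fun ω => (f ω, h ω)) := by
  simp only [condMutualInfo, condEntropy]
  rw [entropy_congr p (f := fun ω => (f ω, g ω, h ω)) (g := fun ω => (g ω, f ω, h ω))
    (by intros; simp only [Prod.mk.injEq]; tauto)]
  ring

theorem mutualInfo_symm (p : Ω → ℝ) (f : Ω → α) (g : Ω → β) :
    mutualInfo p f g = entropy p g - condEntropy p g f := by
  simp only [mutualInfo, condEntropy]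
  rw [entropy_congr p (f := fun ω => (f ω, g ω)) (g := fun ω => (g ω, f ω))
    (by intros; simp only [Prod.mk.injEq]; tauto)]
  ring

open Classical in
/-- Converse bound for a message `f` decoded from the observation `Z`, the side information `T`
and a help letter `V`. -/
theorem condEntropy_message_le {ζ : Type*} [Fintype ζ] {p : Ω → ℝ} (hp : ∀ ω, 0 ≤ p ω)
    (hp1 : ∑ ω, p ω = 1) (f : Ω → α) (T : Ω → γ) (Z : Ω → ζ) (V : Ω → ν) (g : ζ → ν → α) :
    condEntropy p f T ≤ condEntropy p Z T - condEntropy p Z (fun ω => (f ω, T ω))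
      + Real.logb 2 (Fintype.card ν) + 1
      + (∑ ω, if g (Z ω) (V ω) ≠ f ω then p ω else 0) * Real.logb 2 (Fintype.card α) := by
  -- H(Z,f,T) ≤ H(V,Z,f,T) ≤ H(V,Z,T) + Fano ≤ H(Z,T) + log|ν| + Fano, where Fano stands for the two
  -- error terms. How `V` is produced plays no role.
  have h1 := condEntropy_le_fano hp hp1 f (fun ω => (V ω, Z ω, T ω)) (fun x => g x.2.1 x.1)
  have h2 := condEntropy_le_logb_card hp hp1 V (fun ω => (Z ω, T ω))
  have h3 := condEntropy_nonneg hp V (fun ω => (Z ω, f ω, T ω))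
  simp only [condEntropy] at h1 h2 h3 ⊢
  rw [entropy_congr p (f := fun ω => (f ω, V ω, Z ω, T ω)) (g := fun ω => (V ω, Z ω, f ω, T ω))
    (by intros; simp only [Prod.mk.injEq]; tauto)] at h1
  linarith

end Shannon

end

end CompoundMAC

namespace CompoundMAC

noncomputable section

/-! ### Single-letter informations as functions of the input laws -/

section SingleLetter

set_option linter.unusedSectionVars false

variable {Ω 𝒰 X₁ X₂ X₁' X₂' B : Type*} [Fintype Ω] [Fintype 𝒰] [Fintype X₁] [Fintype X₂]
  [Fintype X₁'] [Fintype X₂'] [Fintype B]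

/-- The product of two mass functions. -/
def prodLaw (a : X₁ → ℝ) (b : X₂ → ℝ) : X₁ × X₂ → ℝ := fun x => a x.1 * b x.2

/-- Entropy of the output of the kernel `k` given its inputs, drawn from `q`. -/
def noiseEntropy (k : X₁ → X₂ → B → ℝ) (q : X₁ × X₂ → ℝ) : ℝ :=
  ∑ x, q x * pmfEntropy (k x.1 x.2)

/-- Information between the first input and the output of the kernel `k`, given the second
input, for independent inputs. -/
def rateOne (k : X₁ → X₂ → B → ℝ) (a : X₁ → ℝ) (b : X₂ → ℝ) : ℝ :=
  ∑ x₂, b x₂ * pmfEntropy (fun y => ∑ x₁, a x₁ * k x₁ x₂ y) - noiseEntropy k (prodLaw a b)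

/-- Information between the second input and the output of the kernel `k`, given the first
input, for independent inputs. -/
def rateTwo (k : X₁ → X₂ → B → ℝ) (a : X₁ → ℝ) (b : X₂ → ℝ) : ℝ :=
  rateOne (fun x₂ x₁ => k x₁ x₂) b a

/-- Information between the inputs, drawn from `q`, and the output of the kernel `k`. -/
def rateTotal (k : X₁ → X₂ → B → ℝ) (q : X₁ × X₂ → ℝ) : ℝ :=
  pmfEntropy (fun y => ∑ x, q x * k x.1 x.2 y) - noiseEntropy k q

theorem continuous_noiseEntropy (k : X₁ → X₂ → B → ℝ) : Continuous (noiseEntropy k) := by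
  unfold noiseEntropy
  fun_prop

theorem continuous_prodLaw :
    Continuous fun x : (X₁ → ℝ) × (X₂ → ℝ) => prodLaw x.1 x.2 := by
  unfold prodLaw
  fun_prop

theorem continuous_rateTotal (k : X₁ → X₂ → B → ℝ) : Continuous (rateTotal k) := by
  unfold rateTotal
  exact (continuous_pmfEntropy.comp (by fun_prop)).sub (continuous_noiseEntropy k)

theorem continuous_rateOne (k : X₁ → X₂ → B → ℝ) :
    Continuous fun x : (X₁ → ℝ) × (X₂ → ℝ) => rateOne k x.1 x.2 := by
  unfold rateOne
  refine Continuous.sub (continuous_finsetSum _ fun x₂ _ => ?_)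
    ((continuous_noiseEntropy k).comp continuous_prodLaw)
  exact Continuous.mul (by fun_prop) (continuous_pmfEntropy.comp (by fun_prop))

theorem continuous_rateTwo (k : X₁ → X₂ → B → ℝ) :
    Continuous fun x : (X₁ → ℝ) × (X₂ → ℝ) => rateTwo k x.1 x.2 :=
  (continuous_rateOne fun x₂ x₁ => k x₁ x₂).comp continuous_swap

theorem prob_prodLaw (a : X₁' → ℝ) (b : X₂' → ℝ) (f : X₁' → X₁) (g : X₂' → X₂) :
    prob (prodLaw a b) (Prod.map f g) = prodLaw (prob a f) (prob b g) := by
  classical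
  funext x
  simp only [prob, prodLaw, Fintype.sum_mul_sum, Fintype.sum_prod_type]
  refine Finset.sum_congr rfl fun i _ => Finset.sum_congr rfl fun j _ => ?_
  by_cases h1 : f i = x.1 <;> by_cases h2 : g j = x.2 <;> simp [h1, h2, Prod.ext_iff]

/-- A kernel fed with `f w₁` and `g w₂` sees only the pushforward laws. This lemma and its analogues
for the rates pass from uniform messages to input letters. -/
theorem noiseEntropy_comp (k : X₁ → X₂ → B → ℝ) (q : X₁' × X₂' → ℝ) (f : X₁' → X₁)
    (g : X₂' → X₂) :
    noiseEntropy (fun w₁ w₂ => k (f w₁) (g w₂)) q = noiseEntropy k (prob q (Prod.map f g)) :=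
  sum_mul_comp q (Prod.map f g) fun x => pmfEntropy (k x.1 x.2)

theorem rateTotal_comp (k : X₁ → X₂ → B → ℝ) (q : X₁' × X₂' → ℝ) (f : X₁' → X₁)
    (g : X₂' → X₂) :
    rateTotal (fun w₁ w₂ => k (f w₁) (g w₂)) q = rateTotal k (prob q (Prod.map f g)) := by
  rw [rateTotal, rateTotal, noiseEntropy_comp]
  congr 2
  exact funext fun y => sum_mul_comp q (Prod.map f g) fun x => k x.1 x.2 y

theorem rateOne_comp (k : X₁ → X₂ → B → ℝ) (a : X₁' → ℝ) (b : X₂' → ℝ) (f : X₁' → X₁)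
    (g : X₂' → X₂) :
    rateOne (fun w₁ w₂ => k (f w₁) (g w₂)) a b = rateOne k (prob a f) (prob b g) := by
  rw [rateOne, rateOne, noiseEntropy_comp, prob_prodLaw]
  congr 1
  rw [← sum_mul_comp b g fun x₂ => pmfEntropy fun y => ∑ x₁, prob a f x₁ * k x₁ x₂ y]
  refine Finset.sum_congr rfl fun w₂ _ => ?_
  congr 2
  exact funext fun y => sum_mul_comp a f fun x₁ => k x₁ (g w₂) y

theorem rateTwo_comp (k : X₁ → X₂ → B → ℝ) (a : X₁' → ℝ) (b : X₂' → ℝ) (f : X₁' → X₁)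
    (g : X₂' → X₂) :
    rateTwo (fun w₁ w₂ => k (f w₁) (g w₂)) a b = rateTwo k (prob a f) (prob b g) :=
  rateOne_comp (fun x₂ x₁ => k x₁ x₂) b a g f

theorem sum_mixture_mul (w : 𝒰 → ℝ) (q : 𝒰 → X₁ × X₂ → ℝ) (F : X₁ × X₂ → ℝ) :
    ∑ x, (∑ u, w u • q u) x * F x = ∑ u, w u * ∑ x, q u x * F x := by
  simp_rw [Finset.sum_apply, Pi.smul_apply, smul_eq_mul, Finset.sum_mul, Finset.mul_sum]
  rw [Finset.sum_comm]
  simp_rw [mul_assoc]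

/-- The output entropy is concave in the input law, while the noise entropy is linear in it. -/
theorem rateTotal_concave {k : X₁ → X₂ → B → ℝ} (hk : ∀ x₁ x₂ y, 0 ≤ k x₁ x₂ y) {w : 𝒰 → ℝ}
    (hw : ∀ u, 0 ≤ w u) (hw1 : ∑ u, w u = 1) {q : 𝒰 → X₁ × X₂ → ℝ} (hq : ∀ u x, 0 ≤ q u x) :
    ∑ u, w u * rateTotal k (q u) ≤ rateTotal k (∑ u, w u • q u) := by
  simp_rw [rateTotal, noiseEntropy, sum_mixture_mul, mul_sub, Finset.sum_sub_distrib]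
  exact sub_le_sub_right (pmfEntropy_jensen w hw hw1 _ fun u y =>
    Finset.sum_nonneg fun x _ => mul_nonneg (hq u x) (hk _ _ _)) _

/-- The variables `U, A₁, A₂, Y` have the law `pU p₁ p₂ k`: given `U`, the inputs `A₁` and `A₂`
are independent, and `Y` is the output of the kernel `k`. -/
structure IsMacLaw (p : Ω → ℝ) (U : Ω → 𝒰) (A₁ : Ω → X₁) (A₂ : Ω → X₂) (Y : Ω → B)
    (pU : 𝒰 → ℝ) (p₁ : 𝒰 → X₁ → ℝ) (p₂ : 𝒰 → X₂ → ℝ) (k : 𝒰 → X₁ → X₂ → B → ℝ) : Prop where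
  nonneg : ∀ ω, 0 ≤ p ω
  sum₁ : ∀ u, ∑ x, p₁ u x = 1
  sum₂ : ∀ u, ∑ x, p₂ u x = 1
  sum_kernel : ∀ u x₁ x₂, ∑ y, k u x₁ x₂ y = 1
  law : ∀ u x₁ x₂ y, prob p (fun ω => (Y ω, U ω, A₁ ω, A₂ ω)) (y, u, x₁, x₂) =
    pU u * p₁ u x₁ * p₂ u x₂ * k u x₁ x₂ y

namespace IsMacLaw

variable {p : Ω → ℝ} {U : Ω → 𝒰} {A₁ : Ω → X₁} {A₂ : Ω → X₂} {Y : Ω → B}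
  {pU : 𝒰 → ℝ} {p₁ : 𝒰 → X₁ → ℝ} {p₂ : 𝒰 → X₂ → ℝ} {k : 𝒰 → X₁ → X₂ → B → ℝ}

theorem swap (h : IsMacLaw p U A₁ A₂ Y pU p₁ p₂ k) :
    IsMacLaw p U A₂ A₁ Y pU p₂ p₁ fun u x₂ x₁ => k u x₁ x₂ where
  nonneg := h.nonneg
  sum₁ := h.sum₂
  sum₂ := h.sum₁
  sum_kernel u x₂ x₁ := h.sum_kernel u x₁ x₂
  law u x₂ x₁ y := by
    rw [prob_congr p (g := fun ω => (Y ω, U ω, A₁ ω, A₂ ω)) (b := (y, u, x₁, x₂))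
      (by intro; simp only [Prod.mk.injEq]; tauto), h.law]
    ring

theorem prob_snd (h : IsMacLaw p U A₁ A₂ Y pU p₁ p₂ k) (y : B) (x₂ : X₂) (u : 𝒰) :
    prob p (fun ω => (Y ω, A₂ ω, U ω)) (y, x₂, u) =
      pU u * p₂ u x₂ * ∑ x₁, p₁ u x₁ * k u x₁ x₂ y := by
  rw [← sum_prob_pair p A₁, Finset.mul_sum]
  refine Finset.sum_congr rfl fun x₁ _ => ?_
  rw [prob_congr p (g := fun ω => (Y ω, U ω, A₁ ω, A₂ ω)) (b := (y, u, x₁, x₂))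
      (by intro; simp only [Prod.mk.injEq]; tauto), h.law]
  ring

theorem prob_aux (h : IsMacLaw p U A₁ A₂ Y pU p₁ p₂ k) (y : B) (u : 𝒰) :
    prob p (fun ω => (Y ω, U ω)) (y, u) =
      pU u * ∑ x, prodLaw (p₁ u) (p₂ u) x * k u x.1 x.2 y := by
  rw [← sum_prob_pair p A₂, Fintype.sum_prod_type_right, Finset.mul_sum]
  refine Finset.sum_congr rfl fun x₂ _ => ?_
  rw [prob_congr p (g := fun ω => (Y ω, A₂ ω, U ω)) (b := (y, x₂, u))
      (by intro; simp only [Prod.mk.injEq]; tauto), h.prob_snd, mul_assoc, Finset.mul_sum]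
  congr 1
  refine Finset.sum_congr rfl fun x₁ _ => ?_
  rw [prodLaw]
  ring

theorem prob_output (h : IsMacLaw p U A₁ A₂ Y pU p₁ p₂ k) (y : B) :
    prob p Y y = ∑ u, pU u * ∑ x, prodLaw (p₁ u) (p₂ u) x * k u x.1 x.2 y := by
  rw [← sum_prob_pair p U]
  refine Finset.sum_congr rfl fun u _ => ?_
  rw [← h.prob_aux]
  exact prob_congr p (by intro; simp only [Prod.mk.injEq]; tauto)

theorem condEntropy_inputs (h : IsMacLaw p U A₁ A₂ Y pU p₁ p₂ k) :
    condEntropy p Y (fun ω => (U ω, A₁ ω, A₂ ω)) =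
      ∑ u, pU u * noiseEntropy (k u) (prodLaw (p₁ u) (p₂ u)) := by
  rw [condEntropy_of_kernel h.nonneg Y _ (fun c => pU c.1 * p₁ c.1 c.2.1 * p₂ c.1 c.2.2)
    (fun c => k c.1 c.2.1 c.2.2) (fun y c => h.law _ _ _ _) fun c => h.sum_kernel _ _ _,
    Fintype.sum_prod_type]
  refine Finset.sum_congr rfl fun u _ => ?_
  rw [noiseEntropy, Finset.mul_sum]
  refine Finset.sum_congr rfl fun x _ => ?_
  rw [prodLaw]
  ring

/-- Given U, the inputs are independent, so the law of the output given (A₂, U) is the kernel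
averaged over `p₁`. -/
theorem rate_one (h : IsMacLaw p U A₁ A₂ Y pU p₁ p₂ k) :
    condEntropy p Y (fun ω => (A₂ ω, U ω)) - condEntropy p Y (fun ω => (A₁ ω, A₂ ω, U ω)) =
      ∑ u, pU u * rateOne (k u) (p₁ u) (p₂ u) := by
  rw [condEntropy_congr p Y (g := fun ω => (A₁ ω, A₂ ω, U ω))
    (h := fun ω => (U ω, A₁ ω, A₂ ω)) (by intros; simp only [Prod.mk.injEq]; tauto),
    h.condEntropy_inputs,
    condEntropy_of_kernel h.nonneg Y _ (fun c : X₂ × 𝒰 => pU c.2 * p₂ c.2 c.1)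
      (fun c y => ∑ x₁, p₁ c.2 x₁ * k c.2 x₁ c.1 y) (fun y c => h.prob_snd _ _ _) fun c => ?_,
    Fintype.sum_prod_type_right, ← Finset.sum_sub_distrib]
  · refine Finset.sum_congr rfl fun u _ => ?_
    rw [rateOne, mul_sub, Finset.mul_sum]
    simp_rw [mul_assoc]
  · rw [Finset.sum_comm]
    simp_rw [← Finset.mul_sum, h.sum_kernel, mul_one, h.sum₁]

theorem rate_two (h : IsMacLaw p U A₁ A₂ Y pU p₁ p₂ k) :
    condEntropy p Y (fun ω => (A₁ ω, U ω)) - condEntropy p Y (fun ω => (A₂ ω, A₁ ω, U ω)) =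
      ∑ u, pU u * rateTwo (k u) (p₁ u) (p₂ u) :=
  h.swap.rate_one

theorem rate_pair (h : IsMacLaw p U A₁ A₂ Y pU p₁ p₂ k) :
    condEntropy p Y U - condEntropy p Y (fun ω => ((A₁ ω, A₂ ω), U ω)) =
      ∑ u, pU u * rateTotal (k u) (prodLaw (p₁ u) (p₂ u)) := by
  rw [condEntropy_congr p Y (g := fun ω => ((A₁ ω, A₂ ω), U ω))
    (h := fun ω => (U ω, A₁ ω, A₂ ω)) (by intros; simp only [Prod.mk.injEq]; tauto),
    h.condEntropy_inputs,
    condEntropy_of_kernel h.nonneg Y U pU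
      (fun u y => ∑ x, prodLaw (p₁ u) (p₂ u) x * k u x.1 x.2 y) h.prob_aux fun u => ?_,
    ← Finset.sum_sub_distrib]
  · simp_rw [rateTotal, mul_sub]
  · rw [Finset.sum_comm]
    simp_rw [← Finset.mul_sum, h.sum_kernel, mul_one, Fintype.sum_prod_type, prodLaw,
      ← Finset.mul_sum, h.sum₂, mul_one, h.sum₁]

theorem prob_mixture {k : X₁' → X₂' → B → ℝ} {f : 𝒰 → X₁ → X₁'} {g : 𝒰 → X₂ → X₂'}
    (h : IsMacLaw p U A₁ A₂ Y pU p₁ p₂ fun u x₁ x₂ => k (f u x₁) (g u x₂)) (y : B) :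
    prob p Y y = ∑ x, (∑ u, pU u • prodLaw (prob (p₁ u) (f u)) (prob (p₂ u) (g u))) x *
      k x.1 x.2 y := by
  rw [h.prob_output, sum_mixture_mul]
  refine Finset.sum_congr rfl fun u _ => ?_
  rw [← prob_prodLaw, ← sum_mul_comp (prodLaw (p₁ u) (p₂ u)) (Prod.map (f u) (g u))
    fun x => k x.1 x.2 y]
  rfl

/-- Information between the inputs of the kernel `k` and its output, where the inputs are
functions `f` and `g` of `A₁` and `A₂` that may depend on `U`. -/
theorem rate_total {k : X₁' → X₂' → B → ℝ} {f : 𝒰 → X₁ → X₁'} {g : 𝒰 → X₂ → X₂'}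
    (h : IsMacLaw p U A₁ A₂ Y pU p₁ p₂ fun u x₁ x₂ => k (f u x₁) (g u x₂)) :
    entropy p Y - condEntropy p Y (fun ω => (U ω, A₁ ω, A₂ ω)) =
      rateTotal k (∑ u, pU u • prodLaw (prob (p₁ u) (f u)) (prob (p₂ u) (g u))) := by
  rw [rateTotal, h.condEntropy_inputs, noiseEntropy, sum_mixture_mul]
  congr 1
  · change pmfEntropy (prob p Y) = _
    congr 1
    exact funext h.prob_mixture
  · refine Finset.sum_congr rfl fun u _ => ?_
    rw [← prob_prodLaw, noiseEntropy_comp k (prodLaw (p₁ u) (p₂ u)) (f u) (g u), noiseEntropy]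

/-- Since the kernel does not depend on U, the output given the inputs alone still has law `k`, and
U enters only through the mixed input law. -/
theorem mutualInfo_eq {k : X₁ → X₂ → B → ℝ} (h : IsMacLaw p U A₁ A₂ Y pU p₁ p₂ fun _ => k)
    (hk : ∀ x₁ x₂, ∑ y, k x₁ x₂ y = 1) :
    mutualInfo p (fun ω => (A₁ ω, A₂ ω)) Y =
      rateTotal k (∑ u, pU u • prodLaw (p₁ u) (p₂ u)) := by
  rw [mutualInfo_symm, rateTotal]
  congr 1
  · change pmfEntropy (prob p Y) = _
    congr 1
    funext y
    rw [h.prob_output, sum_mixture_mul]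
  · refine condEntropy_of_kernel h.nonneg Y _ _ (fun x : X₁ × X₂ => k x.1 x.2)
      (fun y x => ?_) fun x => hk _ _
    rw [← sum_prob_pair p U, Finset.sum_apply, Finset.sum_mul]
    refine Finset.sum_congr rfl fun u _ => ?_
    rw [prob_congr p (g := fun ω => (Y ω, U ω, A₁ ω, A₂ ω)) (b := (y, u, x.1, x.2))
      (by intro; simp only [Prod.ext_iff]; tauto), h.law]
    simp only [Pi.smul_apply, prodLaw, smul_eq_mul]
    ring

end IsMacLaw

/-! ### The regions expressed through channel kernels -/

variable {Y₁ Y₂ : Type*} [Fintype Y₁] [Fintype Y₂]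

/-- The channel from the inputs to the observation `π (Y₁, Y₂)`. -/
def outputKernel (W : Channel X₁ X₂ Y₁ Y₂) (π : Y₁ × Y₂ → B) (x₁ : X₁) (x₂ : X₂) (y : B) : ℝ :=
  prob (W x₁ x₂).1 π y

theorem outputKernel_nonneg (W : Channel X₁ X₂ Y₁ Y₂) (π : Y₁ × Y₂ → B) (x₁ : X₁) (x₂ : X₂)
    (y : B) : 0 ≤ outputKernel W π x₁ x₂ y :=
  prob_nonneg (W x₁ x₂).2.1 _ _

theorem sum_outputKernel (W : Channel X₁ X₂ Y₁ Y₂) (π : Y₁ × Y₂ → B) (x₁ : X₁) (x₂ : X₂) :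
    ∑ y, outputKernel W π x₁ x₂ y = 1 :=
  (sum_prob _ _).trans (W x₁ x₂).2.2

theorem isMacLaw_jointLaw (W : Channel X₁ X₂ Y₁ Y₂) (π : Y₁ × Y₂ → B) (pU : stdSimplex ℝ 𝒰)
    (p₁ : 𝒰 → stdSimplex ℝ X₁) (p₂ : 𝒰 → stdSimplex ℝ X₂) :
    IsMacLaw (jointLaw W pU p₁ p₂) rvU rvX₁ rvX₂ (fun ω => π (rvY₁₂ ω)) pU.1
      (fun u => (p₁ u).1) (fun u => (p₂ u).1) fun _ => outputKernel W π where
  nonneg ω := mul_nonneg (mul_nonneg (mul_nonneg (pU.2.1 _) ((p₁ _).2.1 _)) ((p₂ _).2.1 _))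
    ((W _ _).2.1 _)
  sum₁ u := (p₁ u).2.2
  sum₂ u := (p₂ u).2.2
  sum_kernel _ := sum_outputKernel W π
  law u x₁ x₂ y := by
    classical
    have h1 : ∀ (u' : 𝒰) (x₁' : X₁) (x₂' : X₂) (z : Y₁ × Y₂),
        (if π z = y ∧ u' = u ∧ x₁' = x₁ ∧ x₂' = x₂ then
          pU.1 u' * (p₁ u').1 x₁' * (p₂ u').1 x₂' * (W x₁' x₂').1 z else 0) =
        if u' = u then if x₁' = x₁ then if x₂' = x₂ then if π z = y then
          pU.1 u' * (p₁ u').1 x₁' * (p₂ u').1 x₂' * (W x₁' x₂').1 z else 0 else 0 else 0 else 0 := by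
      intro u' x₁' x₂' z
      simp only [← ite_and]
      exact if_congr (by tauto) rfl rfl
    calc prob (jointLaw W pU p₁ p₂) (fun ω => (π (rvY₁₂ ω), rvU ω, rvX₁ ω, rvX₂ ω)) (y, u, x₁, x₂)
        = ∑ u', ∑ x₁', ∑ x₂', ∑ z, (if π z = y ∧ u' = u ∧ x₁' = x₁ ∧ x₂' = x₂ then
          pU.1 u' * (p₁ u').1 x₁' * (p₂ u').1 x₂' * (W x₁' x₂').1 z else 0) := by
          rw [prob, Fintype.sum_prod_type]
          refine Finset.sum_congr rfl fun u' _ => ?_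
          rw [Fintype.sum_prod_type]
          refine Finset.sum_congr rfl fun x₁' _ => ?_
          rw [Fintype.sum_prod_type]
          refine Finset.sum_congr rfl fun x₂' _ => Finset.sum_congr rfl fun z _ => ?_
          simp only [rvY₁₂, rvU, rvX₁, rvX₂, Prod.mk.injEq, jointLaw]
      _ = _ := by
          simp_rw [h1]
          rw [Finset.sum_eq_single u (by intro b _ hb; simp [hb]) (by simp),
            Finset.sum_eq_single x₁ (by intro b _ hb; simp [hb]) (by simp),
            Finset.sum_eq_single x₂ (by intro b _ hb; simp [hb]) (by simp)]
          simp [outputKernel, prob, Finset.mul_sum]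

/-- The rate constraints of a multiple access channel with a common message, for the observation
`π (Y₁, Y₂)`, in terms of the laws of the letters. -/
theorem mem_macRegion_jointLaw (W : Channel X₁ X₂ Y₁ Y₂) (π : Y₁ × Y₂ → B) (pU : stdSimplex ℝ 𝒰)
    (p₁ : 𝒰 → stdSimplex ℝ X₁) (p₂ : 𝒰 → stdSimplex ℝ X₂) (C : ℝ) (R : ℝ × ℝ × ℝ) :
    R ∈ macRegion (jointLaw W pU p₁ p₂) (fun ω => π (rvY₁₂ ω)) C ↔
      0 ≤ R.1 ∧ 0 ≤ R.2.1 ∧ 0 ≤ R.2.2 ∧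
      R.2.1 ≤ ∑ u, pU.1 u * rateOne (outputKernel W π) (p₁ u).1 (p₂ u).1 + C ∧
      R.2.2 ≤ ∑ u, pU.1 u * rateTwo (outputKernel W π) (p₁ u).1 (p₂ u).1 + C ∧
      R.2.1 + R.2.2 ≤
        ∑ u, pU.1 u * rateTotal (outputKernel W π) (prodLaw (p₁ u).1 (p₂ u).1) + C ∧
      R.1 + R.2.1 + R.2.2 ≤
        rateTotal (outputKernel W π) (∑ u, pU.1 u • prodLaw (p₁ u).1 (p₂ u).1) + C := by
  have h := isMacLaw_jointLaw W π pU p₁ p₂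
  rw [← h.rate_one, ← h.rate_two, ← h.rate_pair, ← h.mutualInfo_eq (sum_outputKernel W π)]
  simp only [macRegion, condMutualInfo_symm]
  rfl

end SingleLetter

end

end CompoundMAC

namespace CompoundMAC

noncomputable section

/-! ### From a code to sums of single-letter informations -/

section Converse

set_option linter.unusedSectionVars false

theorem prob_prod_map {ι Y B : Type*} [Fintype ι] [DecidableEq ι] [Fintype Y]
    (r : ι → Y → ℝ) (π : Y → B) (z : ι → B) :
    prob (fun y : ι → Y => ∏ j, r j (y j)) (fun y j => π (y j)) z =
      ∏ j, prob (r j) π (z j) := by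
  classical
  simp only [prob]
  rw [Finset.prod_univ_sum, Fintype.piFinset_univ]
  refine Finset.sum_congr rfl fun y _ => ?_
  by_cases h : (fun j => π (y j)) = z
  · subst h
    simp
  · obtain ⟨j, hj⟩ := Function.ne_iff.1 h
    rw [if_neg h, Finset.prod_eq_zero (Finset.mem_univ j) (if_neg hj)]

/-- A constant joint mass makes `f` uniform and independent of `T`. -/
theorem condEntropy_of_uniform {Ω α γ : Type*} [Fintype Ω] [Fintype α] [Fintype γ]
    [Nonempty α] {p : Ω → ℝ} (hp : ∀ ω, 0 ≤ p ω) (hp1 : ∑ ω, p ω = 1) (f : Ω → α) (T : Ω → γ)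
    (s : ℝ) (h : ∀ a c, prob p (fun ω => (f ω, T ω)) (a, c) = s) :
    condEntropy p f T = Real.logb 2 (Fintype.card α) := by
  have hα : (Fintype.card α : ℝ) ≠ 0 := by simp
  have h1 : ∑ x, prob p (fun ω => (f ω, T ω)) x = 1 := (sum_prob _ _).trans hp1
  rw [Fintype.sum_prod_type_right] at h1
  simp only [h, Finset.sum_const, Finset.card_univ, nsmul_eq_mul] at h1
  rw [condEntropy_of_kernel hp f T (fun _ => Fintype.card α * s)
    (fun _ _ => (Fintype.card α : ℝ)⁻¹) (fun a c => ?_) fun c => ?_]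
  · simp [pmfEntropy, Real.logb_inv, hα, ← mul_assoc] at h1 ⊢
    simp [h1]
  · rw [h]
    field_simp
  · simp [hα]

variable {X₁ X₂ Y₁ Y₂ B ν : Type*} [Fintype X₁] [Fintype X₂] [Fintype Y₁] [Fintype Y₂]
  [Fintype B] [Fintype ν] {M₀ M₁ M₂ n : ℕ}

/-- The joint law of the messages and the channel outputs. -/
def codeLaw (W : Channel X₁ X₂ Y₁ Y₂) (e₁ : Fin M₀ → Fin M₁ → Fin n → X₁)
    (e₂ : Fin M₀ → Fin M₂ → Fin n → X₂) :
    (Fin M₀ × Fin M₁ × Fin M₂) × (Fin n → Y₁ × Y₂) → ℝ :=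
  fun ω => 1 / ((M₀ : ℝ) * M₁ * M₂) *
    ∏ j, (W (e₁ ω.1.1 ω.1.2.1 j) (e₂ ω.1.1 ω.1.2.2 j)).1 (ω.2 j)

/-- The law of the input letter that a message uniform on `Fin M` is encoded to. -/
def letterLaw {X : Type*} {M : ℕ} (e : Fin M → Fin n → X) (i : Fin n) : X → ℝ :=
  prob (fun _ => 1 / (M : ℝ)) fun w => e w i

theorem letterLaw_mem {X : Type*} [Fintype X] {M : ℕ} (hM : 0 < M) (e : Fin M → Fin n → X)
    (i : Fin n) : letterLaw e i ∈ stdSimplex ℝ X := by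
  refine ⟨fun x => prob_nonneg (fun _ => by positivity) _ _, ?_⟩
  rw [letterLaw, sum_prob]
  have : (M : ℝ) ≠ 0 := by positivity
  simp [this]

variable (W : Channel X₁ X₂ Y₁ Y₂) (e₁ : Fin M₀ → Fin M₁ → Fin n → X₁)
  (e₂ : Fin M₀ → Fin M₂ → Fin n → X₂)

theorem codeLaw_nonneg (ω : (Fin M₀ × Fin M₁ × Fin M₂) × (Fin n → Y₁ × Y₂)) :
    0 ≤ codeLaw W e₁ e₂ ω :=
  mul_nonneg (by positivity) (Finset.prod_nonneg fun j _ => (W _ _).2.1 _)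

theorem sum_prod_channel (w : Fin M₀ × Fin M₁ × Fin M₂) :
    ∑ y : Fin n → Y₁ × Y₂, ∏ j, (W (e₁ w.1 w.2.1 j) (e₂ w.1 w.2.2 j)).1 (y j) = 1 := by
  rw [← Fintype.piFinset_univ, ← Finset.prod_univ_sum (fun _ => Finset.univ)
    (fun j y => (W (e₁ w.1 w.2.1 j) (e₂ w.1 w.2.2 j)).1 y)]
  exact Finset.prod_eq_one fun j _ => (W _ _).2.2

theorem sum_codeLaw (h₀ : 0 < M₀) (h₁ : 0 < M₁) (h₂ : 0 < M₂) :
    ∑ ω, codeLaw W e₁ e₂ ω = 1 := by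
  simp_rw [codeLaw, Fintype.sum_prod_type (α₁ := Fin M₀ × Fin M₁ × Fin M₂), ← Finset.mul_sum, sum_prod_channel]
  simp only [Finset.sum_const, Finset.card_univ, nsmul_eq_mul, Fintype.card_prod,
    Fintype.card_fin]
  push_cast
  field_simp

theorem prob_codeLaw {α : Type*} (F : (Fin n → Y₁ × Y₂) → α) (a : α)
    (w : Fin M₀ × Fin M₁ × Fin M₂) :
    prob (codeLaw W e₁ e₂) (fun ω => (F ω.2, ω.1)) (a, w) = 1 / ((M₀ : ℝ) * M₁ * M₂) *
      prob (fun y => ∏ j, (W (e₁ w.1 w.2.1 j) (e₂ w.1 w.2.2 j)).1 (y j)) F a := by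
  classical
  unfold prob
  rw [Fintype.sum_prod_type, Finset.sum_eq_single w (fun w' _ hw => by simp [hw]) (by simp),
    Finset.mul_sum]
  refine Finset.sum_congr rfl fun y _ => ?_
  by_cases hy : F y = a <;> simp [hy, codeLaw]

/-- The common message plays the role of U: given it, the private messages are independent and
uniform. The kernel varies with it because both encoders use it. -/
theorem isMacLaw_codeLaw (h₁ : 0 < M₁) (h₂ : 0 < M₂) (π : Y₁ × Y₂ → B) (i : Fin n) :
    IsMacLaw (codeLaw W e₁ e₂) (fun ω => ω.1.1) (fun ω => ω.1.2.1) (fun ω => ω.1.2.2)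
      (fun ω => π (ω.2 i)) (fun _ => 1 / (M₀ : ℝ)) (fun _ _ => 1 / (M₁ : ℝ))
      (fun _ _ => 1 / (M₂ : ℝ))
      (fun w₀ w₁ w₂ => outputKernel W π (e₁ w₀ w₁ i) (e₂ w₀ w₂ i)) where
  nonneg := codeLaw_nonneg W e₁ e₂
  sum₁ _ := by simp [h₁.ne']
  sum₂ _ := by simp [h₂.ne']
  sum_kernel _ _ _ := sum_outputKernel W π _ _
  law w₀ w₁ w₂ b := by
    classical
    have h := sum_prod_mul_eval (fun j => (W (e₁ w₀ w₁ j) (e₂ w₀ w₂ j)).1)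
      (fun j => (W _ _).2.2) i fun y => if π y = b then 1 else 0
    have h' := prob_codeLaw W e₁ e₂ (fun y => π (y i)) b (w₀, w₁, w₂)
    simp only [mul_ite, mul_one, mul_zero] at h
    simp only [prob, outputKernel] at h' h ⊢
    rw [h', h, one_div_mul_one_div, one_div_mul_one_div]

/-- Once all messages are fixed, so are the input words, and the outputs at different positions are
independent. -/
theorem condEntropy_outputs (h₁ : 0 < M₁) (h₂ : 0 < M₂) (π : Y₁ × Y₂ → B) :
    condEntropy (codeLaw W e₁ e₂) (fun ω j => π (ω.2 j)) (fun ω => ω.1) =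
      ∑ i, condEntropy (codeLaw W e₁ e₂) (fun ω => π (ω.2 i)) (fun ω => ω.1) := by
  have h : ∀ i, condEntropy (codeLaw W e₁ e₂) (fun ω => π (ω.2 i)) (fun ω => ω.1) =
      ∑ w : Fin M₀ × Fin M₁ × Fin M₂, 1 / ((M₀ : ℝ) * M₁ * M₂) *
        pmfEntropy (outputKernel W π (e₁ w.1 w.2.1 i) (e₂ w.1 w.2.2 i)) := fun i =>
    condEntropy_of_kernel (codeLaw_nonneg W e₁ e₂) _ _ _ _ (fun a c =>
      ((isMacLaw_codeLaw W e₁ e₂ h₁ h₂ π i).law _ _ _ _).trans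
        (by rw [one_div_mul_one_div, one_div_mul_one_div])) fun c => sum_outputKernel W π _ _
  simp_rw [h]
  rw [condEntropy_of_kernel (codeLaw_nonneg W e₁ e₂) _ _ (fun _ => 1 / ((M₀ : ℝ) * M₁ * M₂))
    (fun w z => ∏ j, outputKernel W π (e₁ w.1 w.2.1 j) (e₂ w.1 w.2.2 j) (z j))
    (fun z w => ?_) fun w => ?_, Finset.sum_comm]
  · refine Finset.sum_congr rfl fun w _ => ?_
    rw [pmfEntropy_prod _ fun i => sum_outputKernel W π _ _, Finset.mul_sum]
  · rw [prob_codeLaw W e₁ e₂ (fun y j => π (y j)), prob_prod_map]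
    rfl
  · rw [← Fintype.piFinset_univ, ← Finset.prod_univ_sum (fun _ => Finset.univ)
      (fun j y => outputKernel W π (e₁ w.1 w.2.1 j) (e₂ w.1 w.2.2 j) y)]
    exact Finset.prod_eq_one fun j _ => sum_outputKernel W π _ _

/-- Converse bound for the part `f` of the messages, the other messages `T` being known. -/
theorem logb_card_le {α γ : Type*} [Fintype α] [Fintype γ] (h₀ : 0 < M₀) (h₁ : 0 < M₁)
    (h₂ : 0 < M₂) (π : Y₁ × Y₂ → B)
    (V : (Fin M₀ × Fin M₁ × Fin M₂) × (Fin n → Y₁ × Y₂) → ν)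
    (g : (Fin n → B) → ν → Fin M₀ × Fin M₁ × Fin M₂) {L δ : ℝ}
    (hL : Real.logb 2 (Fintype.card ν) ≤ L)
    (hδ : prob (codeLaw W e₁ e₂) (fun ω => g (fun j => π (ω.2 j)) (V ω) = ω.1) False ≤ δ)
    (f : Fin M₀ × Fin M₁ × Fin M₂ → α) (T : Fin M₀ × Fin M₁ × Fin M₂ → γ)
    (E : α × γ ≃ Fin M₀ × Fin M₁ × Fin M₂) (hE : ∀ w, E.symm w = (f w, T w)) :
    Real.logb 2 (Fintype.card α) ≤
      ∑ i, (condEntropy (codeLaw W e₁ e₂) (fun ω => π (ω.2 i)) (fun ω => T ω.1) -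
        condEntropy (codeLaw W e₁ e₂) (fun ω => π (ω.2 i)) (fun ω => (f ω.1, T ω.1)))
      + L + 1 + δ * Real.logb 2 (Fintype.card α) := by
  classical
  have hp := codeLaw_nonneg W e₁ e₂
  have hp1 := sum_codeLaw W e₁ e₂ h₀ h₁ h₂
  have hα : Nonempty α := ⟨f (⟨0, h₀⟩, ⟨0, h₁⟩, ⟨0, h₂⟩)⟩
  have hcongr : ∀ ω ω' : (Fin M₀ × Fin M₁ × Fin M₂) × (Fin n → Y₁ × Y₂),
      (f ω.1, T ω.1) = (f ω'.1, T ω'.1) ↔ ω.1 = ω'.1 := fun ω ω' => by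
    rw [← hE, ← hE, E.symm.injective.eq_iff]
  have hunif : condEntropy (codeLaw W e₁ e₂) (fun ω => f ω.1) (fun ω => T ω.1) =
      Real.logb 2 (Fintype.card α) := by
    refine condEntropy_of_uniform hp hp1 _ _ (1 / ((M₀ : ℝ) * M₁ * M₂)) fun a c => ?_
    rw [prob_congr _ (g := fun ω => ((), ω.1)) (b := ((), E (a, c))) fun ω => ?_,
      prob_codeLaw W e₁ e₂ (fun _ => ())]
    · have := sum_prob (fun y : Fin n → Y₁ × Y₂ => ∏ j, (W (e₁ (E (a, c)).1 (E (a, c)).2.1 j)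
        (e₂ (E (a, c)).1 (E (a, c)).2.2 j)).1 (y j)) fun _ => ()
      rw [sum_prod_channel, Fintype.sum_unique] at this
      exact (congrArg _ this).trans (mul_one _)
    · rw [← hE, Equiv.symm_apply_eq]
      simp
  have h1 := condEntropy_message_le hp hp1 (fun ω => f ω.1) (fun ω => T ω.1)
    (fun ω j => π (ω.2 j)) V fun z v => f (g z v)
  have h2 := condEntropy_pi_le hp hp1 (fun ω j => π (ω.2 j)) fun ω => T ω.1
  rw [hunif, condEntropy_congr _ _ hcongr, condEntropy_outputs W e₁ e₂ h₁ h₂ π] at h1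
  rw [Finset.sum_sub_distrib]
  simp_rw [condEntropy_congr (codeLaw W e₁ e₂) _ hcongr]
  -- A wrong value of `f` forces a wrong message triple.
  have h3 : (∑ ω, if f (g (fun j => π (ω.2 j)) (V ω)) ≠ f ω.1 then codeLaw W e₁ e₂ ω else 0) ≤
      δ := by
    refine le_trans (Finset.sum_le_sum fun ω _ => ?_) hδ
    by_cases h : g (fun j => π (ω.2 j)) (V ω) = ω.1
    · simp [h]
    · simp only [h]
      split_ifs <;> simp [hp]
  have h4 : 0 ≤ Real.logb 2 (Fintype.card α) := Real.logb_nonneg one_lt_two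
    (Nat.one_le_cast.2 Fintype.card_pos)
  have h5 := mul_le_mul_of_nonneg_right h3 h4
  linarith

end Converse

end

end CompoundMAC

/-! ### Compactness of convex hulls -/

namespace CompoundMAC

noncomputable section

/-- The convex hull of a compact set in finite dimension is compact. -/
theorem isCompact_convexHull_of_isCompact {E : Type*} [NormedAddCommGroup E] [NormedSpace ℝ E]
    [FiniteDimensional ℝ E] {s : Set E} (hs : IsCompact s) : IsCompact (convexHull ℝ s) := by
  rcases s.eq_empty_or_nonempty with rfl | ⟨x₀, hx₀⟩
  · simp
  set J := Fin (Module.finrank ℝ E + 1)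
  have himage : convexHull ℝ s = (fun x : (J → ℝ) × (J → E) => ∑ j, x.1 j • x.2 j) ''
      (stdSimplex ℝ J ×ˢ Set.univ.pi fun _ => s) := by
    ext x
    constructor
    · intro hx
      -- Carathéodory: the points can be taken affinely independent, hence at most dim + 1 in
      -- number.
      obtain ⟨ι, _, z, w, hz, hind, hw, hw1, rfl⟩ := eq_pos_convex_span_of_mem_convexHull hx
      have hcard : Fintype.card ι ≤ Fintype.card J := by
        rw [Fintype.card_fin]
        exact hind.card_le_finrank_succ.trans
          (Nat.succ_le_succ (Submodule.finrank_le _))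
      obtain ⟨e⟩ := Function.Embedding.nonempty_of_card_le hcard
      have hw0 : ∀ j ∉ Set.range e, Function.extend e w 0 j = 0 := fun j hj =>
        Function.extend_apply' _ _ _ hj
      -- Unused indices get weight 0 and the dummy point `x₀`.
      refine ⟨(Function.extend e w 0, Function.extend e z fun _ => x₀), ⟨⟨fun j => ?_, ?_⟩, ?_⟩, ?_⟩
      · by_cases hj : j ∈ Set.range e
        · obtain ⟨i, rfl⟩ := hj
          simpa [e.injective.extend_apply] using (hw i).le
        · exact (hw0 j hj).ge
      · rw [← hw1]
        exact (Fintype.sum_of_injective e e.injective _ _ hw0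
          fun i => (e.injective.extend_apply _ _ i).symm).symm
      · intro j _
        by_cases hj : j ∈ Set.range e
        · obtain ⟨i, rfl⟩ := hj
          simpa [e.injective.extend_apply] using hz (Set.mem_range_self i)
        · simpa [Function.extend_apply' _ _ _ hj] using hx₀
      · refine (Fintype.sum_of_injective e e.injective _ _ (fun j hj => ?_) fun i => ?_).symm
        · simp [hw0 j hj]
        · simp [e.injective.extend_apply]
    · rintro ⟨⟨w, z⟩, ⟨hw, hz⟩, rfl⟩
      exact mem_convexHull_of_exists_fintype w z hw.1 hw.2 (fun j => hz j trivial) rfl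
  rw [himage]
  exact ((isCompact_stdSimplex ℝ J).prod (isCompact_univ_pi fun _ => hs)).image (by fun_prop)

/-! ### Closedness of the relaxed outer region -/

section OuterBound

set_option linter.unusedSectionVars false

variable {X₁ X₂ Y₁ Y₂ B ν : Type*} [Fintype X₁] [Fintype X₂] [Fintype Y₁] [Fintype Y₂]
  [Fintype B] [Fintype ν] {M₀ M₁ M₂ n K : ℕ}

/-- The three conditional informations of the kernel `k` for independent inputs. -/
def macPoint (k : X₁ → X₂ → B → ℝ) (x : (X₁ → ℝ) × (X₂ → ℝ)) : ℝ × ℝ × ℝ :=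
  (rateOne k x.1 x.2, rateTwo k x.1 x.2, rateTotal k (prodLaw x.1 x.2))

theorem continuous_macPoint (k : X₁ → X₂ → B → ℝ) : Continuous (macPoint k) :=
  (continuous_rateOne k).prodMk
    ((continuous_rateTwo k).prodMk ((continuous_rateTotal k).comp continuous_prodLaw))

/-- The rate constraints relaxed by `C`, for conditional informations `t` and input law `q`. -/
def MacBound (k : X₁ → X₂ → B → ℝ) (q : X₁ × X₂ → ℝ) (t : ℝ × ℝ × ℝ) (C : ℝ)
    (R : ℝ × ℝ × ℝ) : Prop :=
  R.2.1 ≤ t.1 + C ∧ R.2.2 ≤ t.2.1 + C ∧ R.2.1 + R.2.2 ≤ t.2.2 + C ∧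
    R.1 + R.2.1 + R.2.2 ≤ rateTotal k q + C

theorem isClosed_macBound {α : Type*} [TopologicalSpace α] (k : X₁ → X₂ → B → ℝ)
    {q : α → X₁ × X₂ → ℝ} {t : α → ℝ × ℝ × ℝ} {C : α → ℝ} {R : α → ℝ × ℝ × ℝ}
    (hq : Continuous q) (ht : Continuous t) (hC : Continuous C) (hR : Continuous R) :
    IsClosed {x | MacBound k (q x) (t x) (C x) (R x)} := by
  have h := (continuous_rateTotal k).comp hq
  exact (isClosed_le hR.snd.fst (ht.fst.add hC)).inter
    ((isClosed_le hR.snd.snd (ht.snd.fst.add hC)).inter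
      ((isClosed_le (hR.snd.fst.add hR.snd.snd) (ht.snd.snd.add hC)).inter
        (isClosed_le ((hR.fst.add hR.snd.fst).add hR.snd.snd) (h.add hC))))

/-- The letter law and the conditional informations of the three observations. -/
def letterPoint (W : Channel X₁ X₂ Y₁ Y₂) (x : (X₁ → ℝ) × (X₂ → ℝ)) :
    (X₁ × X₂ → ℝ) × (ℝ × ℝ × ℝ) × (ℝ × ℝ × ℝ) × (ℝ × ℝ × ℝ) :=
  (prodLaw x.1 x.2, macPoint (outputKernel W Prod.fst) x, macPoint (outputKernel W Prod.snd) x,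
    macPoint (outputKernel W id) x)

/-- The points that time sharing of product input laws attains. -/
def letterHull (W : Channel X₁ X₂ Y₁ Y₂) :
    Set ((X₁ × X₂ → ℝ) × (ℝ × ℝ × ℝ) × (ℝ × ℝ × ℝ) × (ℝ × ℝ × ℝ)) :=
  convexHull ℝ (letterPoint W '' (stdSimplex ℝ X₁ ×ˢ stdSimplex ℝ X₂))

theorem isCompact_letterHull (W : Channel X₁ X₂ Y₁ Y₂) : IsCompact (letterHull W) := by
  refine isCompact_convexHull_of_isCompact
    (((isCompact_stdSimplex ℝ X₁).prod (isCompact_stdSimplex ℝ X₂)).image ?_)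
  exact continuous_prodLaw.prodMk ((continuous_macPoint _).prodMk
    ((continuous_macPoint _).prodMk (continuous_macPoint _)))

/-- The outer region, with all bounds relaxed by a further slack. -/
def relaxedRegion (W : Channel X₁ X₂ Y₁ Y₂) (C₁₂ C₂₁ : ℝ) : Set ((ℝ × ℝ × ℝ) × ℝ) :=
  {x | ∃ z ∈ letterHull W, (0 ≤ x.1.1 ∧ 0 ≤ x.1.2.1 ∧ 0 ≤ x.1.2.2) ∧
    MacBound (outputKernel W Prod.fst) z.1 z.2.1 (C₂₁ + x.2) x.1 ∧
    MacBound (outputKernel W Prod.snd) z.1 z.2.2.1 (C₁₂ + x.2) x.1 ∧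
    MacBound (outputKernel W id) z.1 z.2.2.2 (0 + x.2) x.1}

/-- The constraints are closed jointly in (z, R, η), and projecting out `z`, which ranges over a
compact space, preserves closedness. -/
theorem isClosed_relaxedRegion (W : Channel X₁ X₂ Y₁ Y₂) (C₁₂ C₂₁ : ℝ) :
    IsClosed (relaxedRegion W C₁₂ C₂₁) := by
  have : CompactSpace (letterHull W) := isCompact_iff_compactSpace.1 (isCompact_letterHull W)
  set S : Set (letterHull W × ((ℝ × ℝ × ℝ) × ℝ)) :=
    {x | (0 ≤ x.2.1.1 ∧ 0 ≤ x.2.1.2.1 ∧ 0 ≤ x.2.1.2.2) ∧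
      MacBound (outputKernel W Prod.fst) x.1.1.1 x.1.1.2.1 (C₂₁ + x.2.2) x.2.1 ∧
      MacBound (outputKernel W Prod.snd) x.1.1.1 x.1.1.2.2.1 (C₁₂ + x.2.2) x.2.1 ∧
      MacBound (outputKernel W id) x.1.1.1 x.1.1.2.2.2 (0 + x.2.2) x.2.1}
  have hz : Continuous fun x : letterHull W × ((ℝ × ℝ × ℝ) × ℝ) => x.1.1 := by fun_prop
  have hR : Continuous fun x : letterHull W × ((ℝ × ℝ × ℝ) × ℝ) => x.2.1 := by fun_prop
  have hη : Continuous fun x : letterHull W × ((ℝ × ℝ × ℝ) × ℝ) => x.2.2 := by fun_prop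
  have hS : IsClosed S :=
    ((isClosed_le continuous_const hR.fst).inter
      ((isClosed_le continuous_const hR.snd.fst).inter
        (isClosed_le continuous_const hR.snd.snd))).inter
    ((isClosed_macBound _ hz.fst hz.snd.fst (continuous_const.add hη) hR).inter
      ((isClosed_macBound _ hz.fst hz.snd.snd.fst (continuous_const.add hη) hR).inter
        (isClosed_macBound _ hz.fst hz.snd.snd.snd (continuous_const.add hη) hR)))
  have h : relaxedRegion W C₁₂ C₂₁ = Prod.snd '' S := by
    ext x
    constructor
    · rintro ⟨z, hz, h⟩
      exact ⟨(⟨z, hz⟩, x), h, rfl⟩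
    · rintro ⟨⟨z, x⟩, h, rfl⟩
      exact ⟨z.1, z.2, h⟩
  rw [h]
  exact isClosedMap_snd_of_compactSpace S hS

theorem mem_macRegion_of_macBound {U : Type*} [Fintype U] {W : Channel X₁ X₂ Y₁ Y₂}
    {π : Y₁ × Y₂ → B} {pU : stdSimplex ℝ U} {p₁ : U → stdSimplex ℝ X₁}
    {p₂ : U → stdSimplex ℝ X₂} {C : ℝ} {R : ℝ × ℝ × ℝ} (hR : 0 ≤ R.1 ∧ 0 ≤ R.2.1 ∧ 0 ≤ R.2.2)
    (h : MacBound (outputKernel W π) (∑ u, pU.1 u • prodLaw (p₁ u).1 (p₂ u).1)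
      (∑ u, pU.1 u • macPoint (outputKernel W π) ((p₁ u).1, (p₂ u).1)) C R) :
    R ∈ macRegion (jointLaw W pU p₁ p₂) (fun ω => π (rvY₁₂ ω)) C := by
  rw [mem_macRegion_jointLaw]
  simp only [MacBound, macPoint, Prod.fst_sum, Prod.snd_sum, Prod.smul_mk, smul_eq_mul] at h
  tauto

/-- A point of the hull is a finite convex combination of letter points: its index set becomes the
alphabet of U, its weights become `pU`, and its points give the input laws shared by all three
observations. -/
theorem mem_outerRegion_of_relaxed {W : Channel X₁ X₂ Y₁ Y₂} {C₁₂ C₂₁ : ℝ} {R : ℝ × ℝ × ℝ}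
    (h : (R, 0) ∈ relaxedRegion W C₁₂ C₂₁) : R ∈ outerRegion W C₁₂ C₂₁ := by
  obtain ⟨z, hz, hR, h1, h2, h3⟩ := h
  obtain ⟨ι, _, w, x, hw, hw1, hx, rfl⟩ := mem_convexHull_iff_exists_fintype.1 hz
  choose x hx hxz using hx
  obtain rfl : (fun i => letterPoint W (x i)) = _ := funext hxz
  let e := (Fintype.equivFin ι).symm
  simp only [outerRegion, Set.mem_iUnion]
  refine ⟨Fintype.card ι, ⟨fun i => w (e i), fun i => hw _, ?_⟩,
    fun i => ⟨(x (e i)).1, (hx (e i)).1⟩, fun i => ⟨(x (e i)).2, (hx (e i)).2⟩, ?_⟩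
  · rw [e.sum_comp w, hw1]
  simp only [add_zero, Prod.fst_sum, Prod.snd_sum, letterPoint, Prod.smul_mk] at h1 h2 h3
  rw [← e.sum_comp, ← e.sum_comp] at h1 h2 h3
  exact ⟨⟨mem_macRegion_of_macBound (π := Prod.fst) hR h1,
    mem_macRegion_of_macBound (π := Prod.snd) hR h2⟩,
    mem_macRegion_of_macBound (π := id) hR h3⟩

/-! ### Rate bounds from a single code -/

/-- Division of the converse bound by n. Rounding the message counts costs at most 1 bit for each of
at most three messages, and Fano's inequality one more: hence 3 in `hr` and 4 in `hη`. -/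
theorem rate_le_of_logb_le {n l t L δ r s C η : ℝ} (hn : 0 < n) (hδ : 0 ≤ δ)
    (h : l ≤ n * t + L + 1 + δ * l) (hr : n * r - 3 ≤ l) (hs : l ≤ n * s) (hL : L ≤ n * C)
    (hη : 4 + δ * (n * s) ≤ n * η) : r ≤ t + (C + η) := by
  have := mul_le_mul_of_nonneg_left hs hδ
  refine le_of_mul_le_mul_left ?_ hn
  linarith

theorem logb_messageCount (n : ℕ) {R : ℝ} (hR : 0 ≤ R) :
    0 < messageCount n R ∧ n * R - 1 ≤ Real.logb 2 (messageCount n R) ∧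
      Real.logb 2 (messageCount n R) ≤ n * R := by
  have h1 : (1 : ℝ) ≤ 2 ^ ((n : ℝ) * R) := Real.one_le_rpow one_le_two (by positivity)
  have h2 : 0 < messageCount n R := Nat.floor_pos.2 h1
  have h3 : (0 : ℝ) < messageCount n R := Nat.cast_pos.2 h2
  refine ⟨h2, ?_, ?_⟩
  · rw [Real.le_logb_iff_rpow_le one_lt_two h3, Real.rpow_sub two_pos, Real.rpow_one]
    have h4 := Nat.lt_floor_add_one ((2 : ℝ) ^ ((n : ℝ) * R))
    have h5 : (1 : ℝ) ≤ messageCount n R := Nat.one_le_cast.2 h2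
    rw [messageCount] at h5 ⊢
    linarith
  · rw [Real.logb_le_iff_le_rpow one_lt_two h3]
    exact Nat.floor_le (by positivity)

/-- Converse for one observation `π (Y₁, Y₂)` that comes with a help letter `V`. -/
theorem macBound_of_code (W : Channel X₁ X₂ Y₁ Y₂) {R : ℝ × ℝ × ℝ}
    (hR : 0 ≤ R.1 ∧ 0 ≤ R.2.1 ∧ 0 ≤ R.2.2) (hn : 0 < n)
    (e₁ : Fin (messageCount n R.1) → Fin (messageCount n R.2.1) → Fin n → X₁)
    (e₂ : Fin (messageCount n R.1) → Fin (messageCount n R.2.2) → Fin n → X₂)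
    (π : Y₁ × Y₂ → B) (V : (Fin n → Y₁ × Y₂) → ν)
    (g : (Fin n → B) → ν → Fin (messageCount n R.1) × Fin (messageCount n R.2.1) ×
      Fin (messageCount n R.2.2)) {C δ η : ℝ} (hδ0 : 0 ≤ δ)
    (hC : Real.logb 2 (Fintype.card ν) ≤ n * C)
    (hδ : prob (codeLaw W e₁ e₂) (fun ω => g (fun j => π (ω.2 j)) (V ω.2) = ω.1) False ≤ δ)
    (hη : 4 + δ * (n * (R.1 + R.2.1 + R.2.2)) ≤ n * η) :
    MacBound (outputKernel W π)
      (∑ x : Fin n × Fin (messageCount n R.1), (1 / (n : ℝ) * (1 / (messageCount n R.1 : ℝ))) •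
        prodLaw (letterLaw (e₁ x.2) x.1) (letterLaw (e₂ x.2) x.1))
      (∑ x : Fin n × Fin (messageCount n R.1), (1 / (n : ℝ) * (1 / (messageCount n R.1 : ℝ))) •
        macPoint (outputKernel W π) (letterLaw (e₁ x.2) x.1, letterLaw (e₂ x.2) x.1))
      (C + η) R := by
  obtain ⟨hR₀, hR₁, hR₂⟩ := hR
  obtain ⟨m₀, l₀, u₀⟩ := logb_messageCount n hR₀
  obtain ⟨m₁, l₁, u₁⟩ := logb_messageCount n hR₁
  obtain ⟨m₂, l₂, u₂⟩ := logb_messageCount n hR₂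
  have hn' : (0 : ℝ) < n := Nat.cast_pos.2 hn
  have hnR₀ : 0 ≤ n * R.1 := by positivity
  have hnR₁ : 0 ≤ n * R.2.1 := by positivity
  have hnR₂ : 0 ≤ n * R.2.2 := by positivity
  generalize messageCount n R.1 = M₀ at *
  generalize messageCount n R.2.1 = M₁ at *
  generalize messageCount n R.2.2 = M₂ at *
  have h₀ : (M₀ : ℝ) ≠ 0 := by positivity
  have h₁ : (M₁ : ℝ) ≠ 0 := by positivity
  have h₂ : (M₂ : ℝ) ≠ 0 := by positivity
  have law := isMacLaw_codeLaw W e₁ e₂ m₁ m₂ π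
  -- The pair (position, common message), uniformly distributed, is the auxiliary variable U.
  have avg : ∀ F : Fin n → Fin M₀ → ℝ, ∑ i, ∑ u, 1 / (M₀ : ℝ) * F i u =
      n * ∑ x : Fin n × Fin M₀, 1 / (n : ℝ) * (1 / (M₀ : ℝ)) * F x.1 x.2 := fun F => by
    rw [Fintype.sum_prod_type, Finset.mul_sum]
    refine Finset.sum_congr rfl fun i _ => ?_
    rw [Finset.mul_sum]
    refine Finset.sum_congr rfl fun u _ => ?_
    field_simp
  simp only [MacBound, macPoint, Prod.fst_sum, Prod.snd_sum, Prod.smul_mk, smul_eq_mul]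
  refine ⟨?_, ?_, ?_, ?_⟩
  · have h := logb_card_le W e₁ e₂ m₀ m₁ m₂ π (fun ω => V ω.2) g hC hδ (fun w => w.2.1)
      (fun w => (w.2.2, w.1)) ⟨fun x => (x.2.2, x.1, x.2.1), fun w => (w.2.1, w.2.2, w.1),
        fun _ => rfl, fun _ => rfl⟩ fun _ => rfl
    rw [Finset.sum_congr rfl fun i _ => (law i).rate_one] at h
    have hi : ∀ i u, rateOne (fun w₁ w₂ => outputKernel W π (e₁ u w₁ i) (e₂ u w₂ i))
        (fun _ => 1 / (M₁ : ℝ)) (fun _ => 1 / (M₂ : ℝ)) =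
        rateOne (outputKernel W π) (letterLaw (e₁ u) i) (letterLaw (e₂ u) i) := fun i u =>
      rateOne_comp _ _ _ (fun w₁ => e₁ u w₁ i) fun w₂ => e₂ u w₂ i
    simp only [hi] at h
    rw [avg, Fintype.card_fin] at h
    exact rate_le_of_logb_le hn' hδ0 h (by linarith) (by linarith) le_rfl hη
  · have h := logb_card_le W e₁ e₂ m₀ m₁ m₂ π (fun ω => V ω.2) g hC hδ (fun w => w.2.2)
      (fun w => (w.2.1, w.1)) ⟨fun x => (x.2.2, x.2.1, x.1), fun w => (w.2.2, w.2.1, w.1),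
        fun _ => rfl, fun _ => rfl⟩ fun _ => rfl
    rw [Finset.sum_congr rfl fun i _ => (law i).rate_two] at h
    have hi : ∀ i u, rateTwo (fun w₁ w₂ => outputKernel W π (e₁ u w₁ i) (e₂ u w₂ i))
        (fun _ => 1 / (M₁ : ℝ)) (fun _ => 1 / (M₂ : ℝ)) =
        rateTwo (outputKernel W π) (letterLaw (e₁ u) i) (letterLaw (e₂ u) i) := fun i u =>
      rateTwo_comp _ _ _ (fun w₁ => e₁ u w₁ i) fun w₂ => e₂ u w₂ i
    simp only [hi] at h
    rw [avg, Fintype.card_fin] at h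
    exact rate_le_of_logb_le hn' hδ0 h (by linarith) (by linarith) le_rfl hη
  · have h := logb_card_le W e₁ e₂ m₀ m₁ m₂ π (fun ω => V ω.2) g hC hδ (fun w => (w.2.1, w.2.2))
      (fun w => w.1) ⟨fun x => (x.2, x.1), fun w => (w.2, w.1),
        fun _ => rfl, fun _ => rfl⟩ fun _ => rfl
    rw [Finset.sum_congr rfl fun i _ => (law i).rate_pair] at h
    have hi : ∀ i u, rateTotal (fun w₁ w₂ => outputKernel W π (e₁ u w₁ i) (e₂ u w₂ i))
        (prodLaw (fun _ => 1 / (M₁ : ℝ)) (fun _ => 1 / (M₂ : ℝ))) =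
        rateTotal (outputKernel W π)
          (prodLaw (letterLaw (e₁ u) i) (letterLaw (e₂ u) i)) := fun i u =>
      (rateTotal_comp _ _ (fun w₁ => e₁ u w₁ i) fun w₂ => e₂ u w₂ i).trans
        (by rw [prob_prodLaw]; rfl)
    simp only [hi] at h
    rw [avg, Fintype.card_prod, Fintype.card_fin, Fintype.card_fin, Nat.cast_mul,
      Real.logb_mul h₁ h₂] at h
    exact rate_le_of_logb_le hn' hδ0 h (by linarith) (by linarith) le_rfl hη
  -- All messages are decoded and nothing is known, so each position contributes the information of
  -- its own mixed input law.
  · have h := logb_card_le W e₁ e₂ m₀ m₁ m₂ π (fun ω => V ω.2) g hC hδ (fun w => w)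
      (fun _ => ()) (Equiv.prodPUnit _) fun _ => rfl
    have hi : ∀ i, condEntropy (codeLaw W e₁ e₂) (fun ω => π (ω.2 i)) (fun _ => ()) -
        condEntropy (codeLaw W e₁ e₂) (fun ω => π (ω.2 i)) (fun ω => (ω.1, ())) =
        rateTotal (outputKernel W π) (∑ u, (1 / (M₀ : ℝ)) •
          prodLaw (letterLaw (e₁ u) i) (letterLaw (e₂ u) i)) := fun i => by
      rw [condEntropy_const (sum_codeLaw W e₁ e₂ m₀ m₁ m₂),
        condEntropy_congr (codeLaw W e₁ e₂) (fun ω => π (ω.2 i))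
          (g := fun ω : (Fin M₀ × Fin M₁ × Fin M₂) × (Fin n → Y₁ × Y₂) => (ω.1, ()))
          (h := fun ω => ω.1) (by simp)]
      exact (law i).rate_total
    rw [Finset.sum_congr rfl fun i _ => hi i, Fintype.card_prod, Fintype.card_prod,
      Fintype.card_fin, Fintype.card_fin, Fintype.card_fin, Nat.cast_mul, Nat.cast_mul,
      Real.logb_mul h₀ (mul_ne_zero h₁ h₂), Real.logb_mul h₁ h₂] at h
    -- Concavity moves the average over positions inside the input law.
    have hc := rateTotal_concave (outputKernel_nonneg W π) (w := fun _ : Fin n => 1 / (n : ℝ))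
      (fun _ => by positivity) (by simp [hn.ne'])
      (q := fun i => ∑ u, (1 / (M₀ : ℝ)) • prodLaw (letterLaw (e₁ u) i) (letterLaw (e₂ u) i))
      fun i x => by
        rw [Finset.sum_apply]
        exact Finset.sum_nonneg fun u _ => mul_nonneg (by positivity)
          (mul_nonneg ((letterLaw_mem m₁ _ _).1 _) ((letterLaw_mem m₂ _ _).1 _))
    rw [← Finset.mul_sum, one_div_mul_eq_div, div_le_iff₀' hn'] at hc
    simp only [Finset.smul_sum, smul_smul] at hc
    rw [Fintype.sum_prod_type]
    exact rate_le_of_logb_le hn' hδ0 (h.trans (by linarith)) (by linarith) (by linarith) le_rfl hη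

open Classical in
theorem errorProb_eq_sum (c : Code X₁ X₂ Y₁ Y₂ M₀ M₁ M₂ n K) (W : Channel X₁ X₂ Y₁ Y₂) :
    c.errorProb W = ∑ ω, if c.est₁ (fun j => (ω.2 j).1) (fun j => (ω.2 j).2) ≠ ω.1 ∨
      c.est₂ (fun j => (ω.2 j).1) (fun j => (ω.2 j).2) ≠ ω.1 then
        codeLaw W c.enc₁ c.enc₂ ω else 0 := by
  rw [Code.errorProb, Fintype.sum_prod_type (α₁ := Fin M₀ × Fin M₁ × Fin M₂), Finset.mul_sum]
  refine Finset.sum_congr rfl fun w _ => ?_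
  rw [← Fintype.sum_prod_type', Finset.mul_sum]
  refine Fintype.sum_equiv (Equiv.arrowProdEquivProdArrow (Fin n) (fun _ => Y₁)
    (fun _ => Y₂)).symm _ _ fun y => ?_
  rw [mul_ite, mul_zero]
  rfl

/-- Nonemptiness excludes `v k = 0`, where the logarithm of the product would not split. -/
theorem logb_card_pi {v : Fin K → ℕ} (h : Nonempty (∀ k, Fin (v k))) :
    Real.logb 2 (Fintype.card (∀ k, Fin (v k))) = ∑ k, Real.logb 2 (v k) := by
  obtain ⟨x⟩ := h
  rw [Fintype.card_pi, Nat.cast_prod, Real.logb_prod]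
  · simp
  · intro k _
    have := (x k).pos
    simp [this.ne']

theorem mem_relaxedRegion_of_achievable {W : Channel X₁ X₂ Y₁ Y₂} {C₁₂ C₂₁ : ℝ}
    {R : ℝ × ℝ × ℝ} (h : Achievable W C₁₂ C₂₁ R) {η : ℝ} (hη : 0 < η) :
    (R, η) ∈ relaxedRegion W C₁₂ C₂₁ := by
  obtain ⟨h₀, h₁, h₂, h⟩ := h
  set s := R.1 + R.2.1 + R.2.2
  have hs : 0 ≤ s := by positivity
  -- With this error the Fano term is at most nη/2, and n ≥ 8/η makes the constant 4 at most nη/2.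
  -- The summand 1 keeps the denominator positive when s = 0.
  obtain ⟨N, hN⟩ := h (η / (2 * (s + 1))) (by positivity)
  obtain ⟨n, hn⟩ := exists_nat_ge (max (N : ℝ) (8 / η))
  obtain ⟨hn1, hn2⟩ := max_le_iff.1 hn
  have hn' : (0 : ℝ) < n := lt_of_lt_of_le (by positivity) hn2
  have hn0 : 0 < n := Nat.cast_pos.1 hn'
  obtain ⟨K, c, hc₁, hc₂, hc⟩ := hN n (Nat.cast_le.1 hn1)
  have hslack : 4 + η / (2 * (s + 1)) * (n * s) ≤ n * η := by
    rw [div_le_iff₀ hη] at hn2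
    have h1 : η / (2 * (s + 1)) * (n * s) ≤ n * η / 2 := by
      rw [div_mul_eq_mul_div, div_le_iff₀ (by positivity)]
      have : 0 ≤ n * η := by positivity
      nlinarith
    linarith
  have hδ0 : 0 ≤ η / (2 * (s + 1)) := by positivity
  have m₀ := (logb_messageCount n h₀).1
  have m₁ := (logb_messageCount n h₁).1
  have m₂ := (logb_messageCount n h₂).1
  have hm₀ : (0 : ℝ) < messageCount n R.1 := Nat.cast_pos.2 m₀
  -- An output block exists because the code law has total mass 1; its transcript then shows that
  -- the conferencing alphabets are nonempty.
  have hY : Nonempty (Fin n → Y₁ × Y₂) := by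
    by_contra hY
    rw [not_nonempty_iff] at hY
    simpa using sum_codeLaw W c.enc₁ c.enc₂ m₀ m₁ m₂
  obtain ⟨y⟩ := hY
  classical
  rw [errorProb_eq_sum] at hc
  have hp := codeLaw_nonneg W c.enc₁ c.enc₂
  have err₁ : prob (codeLaw W c.enc₁ c.enc₂) (fun ω =>
      c.est₁ (fun j => (ω.2 j).1) (fun j => (ω.2 j).2) = ω.1) False ≤ η / (2 * (s + 1)) := by
    refine le_trans (Finset.sum_le_sum fun ω _ => ?_) hc
    have := hp ω
    split_ifs <;> simp_all
  have err₂ : prob (codeLaw W c.enc₁ c.enc₂) (fun ω =>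
      c.est₂ (fun j => (ω.2 j).1) (fun j => (ω.2 j).2) = ω.1) False ≤ η / (2 * (s + 1)) := by
    refine le_trans (Finset.sum_le_sum fun ω _ => ?_) hc
    have := hp ω
    split_ifs <;> simp_all
  refine ⟨∑ x : Fin n × Fin (messageCount n R.1),
    (1 / (n : ℝ) * (1 / (messageCount n R.1 : ℝ))) •
      letterPoint W (letterLaw (c.enc₁ x.2) x.1, letterLaw (c.enc₂ x.2) x.1),
    (convex_convexHull ℝ _).sum_mem (fun _ _ => by positivity) ?_ fun x _ =>
      subset_convexHull ℝ _ ⟨_, ⟨letterLaw_mem m₁ _ _, letterLaw_mem m₂ _ _⟩, rfl⟩,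
    ⟨h₀, h₁, h₂⟩, ?_⟩
  · simp only [Finset.sum_const, Finset.card_univ, Fintype.card_prod, Fintype.card_fin,
      nsmul_eq_mul, Nat.cast_mul]
    field_simp
  simp only [Prod.fst_sum, Prod.snd_sum, letterPoint, Prod.smul_mk]
  refine ⟨?_, ?_, ?_⟩
  -- The help letter is the full list of letters received from decoder 2, a function of both output
  -- blocks.
  · refine macBound_of_code W ⟨h₀, h₁, h₂⟩ hn0 c.enc₁ c.enc₂ Prod.fst
      (fun y k => (c.transcript (fun j => (y j).1) (fun j => (y j).2) k).2) c.dec₁ hδ0 ?_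
      err₁ hslack
    rwa [logb_card_pi ⟨fun k => (c.transcript (fun j => (y j).1) (fun j => (y j).2) k).2⟩]
  · refine macBound_of_code W ⟨h₀, h₁, h₂⟩ hn0 c.enc₁ c.enc₂ Prod.snd
      (fun y k => (c.transcript (fun j => (y j).1) (fun j => (y j).2) k).1) c.dec₂ hδ0 ?_
      err₂ hslack
    rwa [logb_card_pi ⟨fun k => (c.transcript (fun j => (y j).1) (fun j => (y j).2) k).1⟩]
  -- A receiver that sees both outputs computes the estimate of decoder 1 itself; the help letter is
  -- trivial.
  · exact macBound_of_code W ⟨h₀, h₁, h₂⟩ hn0 c.enc₁ c.enc₂ id (fun _ => ())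
      (fun y _ => c.est₁ (fun j => (y j).1) (fun j => (y j).2)) hδ0 (by simp) err₁ hslack

/-- Closedness of the relaxed region is used twice: along η → 0 for a fixed achievable triple, then
on the slice η = 0 to absorb the closure. -/
theorem capacityRegion_subset_outerRegion (W : Channel X₁ X₂ Y₁ Y₂) (C₁₂ C₂₁ : ℝ) :
    capacityRegion W C₁₂ C₂₁ ⊆ outerRegion W C₁₂ C₂₁ := by
  intro R hR
  refine mem_outerRegion_of_relaxed ?_
  have hcl := isClosed_relaxedRegion W C₁₂ C₂₁
  have hzero : {R | Achievable W C₁₂ C₂₁ R} ⊆ {R | (R, (0 : ℝ)) ∈ relaxedRegion W C₁₂ C₂₁} := by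
    intro R hR
    have hlim : Filter.Tendsto (fun η : ℝ => (R, η)) (nhdsWithin 0 (Set.Ioi 0)) (nhds (R, 0)) :=
      ((Continuous.prodMk_right R).tendsto 0).mono_left nhdsWithin_le_nhds
    exact hcl.mem_of_tendsto hlim
      (eventually_nhdsWithin_of_forall fun η hη => mem_relaxedRegion_of_achievable hR hη)
  exact closure_minimal hzero (hcl.preimage (by fun_prop)) hR

theorem outerRegion_eq_explicit (W : Channel X₁ X₂ Y₁ Y₂) (C₁₂ C₂₁ : ℝ) :
    outerRegion W C₁₂ C₂₁ = outerRegionExplicit W C₁₂ C₂₁ := by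
  ext R
  simp only [outerRegion, outerRegionExplicit, macRegion, Set.mem_iUnion, Set.mem_inter_iff,
    Set.mem_ofPred_eq, le_min_iff, add_zero]
  refine exists_congr fun m => exists_congr fun pU => exists_congr fun p₁ =>
    exists_congr fun p₂ => ?_
  tauto

end OuterBound

end

end CompoundMAC

theorem proposition1 {X₁ X₂ Y₁ Y₂ : Type*} [Fintype X₁] [Fintype X₂] [Fintype Y₁] [Fintype Y₂]
    (W : CompoundMAC.Channel X₁ X₂ Y₁ Y₂) (C₁₂ C₂₁ : ℝ) (hC₁₂ : 0 ≤ C₁₂) (hC₂₁ : 0 ≤ C₂₁) :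
    CompoundMAC.capacityRegion W C₁₂ C₂₁ ⊆ CompoundMAC.outerRegion W C₁₂ C₂₁ ∧
    CompoundMAC.outerRegion W C₁₂ C₂₁ = CompoundMAC.outerRegionExplicit W C₁₂ C₂₁ :=
  ⟨CompoundMAC.capacityRegion_subset_outerRegion W C₁₂ C₂₁,
    CompoundMAC.outerRegion_eq_explicit W C₁₂ C₂₁⟩
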